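/- Let $d\ge 1$ be an integer. For $s>0$ and a finite set $\omega\subset\mathbb R^d$ put $$E_s(\omega)=\sum_{y\in\omega}\ \sum_{x\in\omega,\,x\ne y}\frac1{|x-y|^s},\qquad \mathcal E_s(A,N)=\inf\{E_s(\omega):\ \omega\subset A,\ |\omega|=N\}\quad(\inf\emptyset=\infty),$$ where $|\cdot|$ is the Euclidean norm, and let $\mathcal H_d$ denote Lebesgue measure on $\mathbb R^d$ and $\mathcal B^d$ the closed unit ball. For every $s>d$ the limit $$C_{s,d}:=\lim_{N\to\infty}\frac{\mathcal E_s([0,1]^d,N)}{N^{1+s/d}}$$ exists, is finite and is positive. Let $A\subset\mathbb R^d$ be compact with $\mathcal H_d(A)>0$, and for each $N$ let $\omega_N=\{x_{1,N},\dots,x_{N,N}\}\subset A$ be a set of $N$ distinct points. Suppose that $(\omega_N)$ is asymptotically optimal in the sense that, for some real $s>d$, $$\lim_{N\to\infty}\frac{E_s(\omega_N)}{N^{1+s/d}}=\frac{C_{s,d}}{\mathcal H_d(A)^{s/d}},$$ or that $$\lim_{N\to\infty}\frac{E_d(\omega_N)}{N^2\log N}=\frac{\mathcal H_d(\mathcal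 B^d)}{\mathcal H_d(A)}.$$ Then, in the weak-star topology of measures, $$\frac1N\sum_{i=1}^N\delta_{x_{i,N}}\longrightarrow\frac{\mathcal H_d(\cdot)|_A}{\mathcal H_d(A)}\qquad(N\to\infty),$$ where $\delta_x$ is the unit point mass at $x$. -/

import Mathlib

open Filter Topology MeasureTheory
open scoped ENNReal NNReal

namespace Riesz

/-- The Riesz `s`-energy of a finite set of distinct points: the sum of `1 / |x - y| ^ s` over all
ordered pairs of distinct points of `ω` (all the terms are finite). -/
noncomputable def energy {d : ℕ} (s : ℝ) (ω : Finset (EuclideanSpace ℝ (Fin d))) : ℝ≥0∞ :=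
  open Classical in ∑ y ∈ ω, ∑ x ∈ ω.erase y, 1 / edist x y ^ s

/-- The `N`-point minimal `s`-energy over `A`; it is `∞` if `A` has fewer than `N` points. -/
noncomputable def minEnergy {d : ℕ} (s : ℝ) (A : Set (EuclideanSpace ℝ (Fin d))) (N : ℕ) : ℝ≥0∞ :=
  ⨅ (ω : Finset (EuclideanSpace ℝ (Fin d))) (_ : ω.card = N ∧ (ω : Set _) ⊆ A), energy s ω

/-- The unit cube `[0,1]^d`. -/
def unitCube (d : ℕ) : Set (EuclideanSpace ℝ (Fin d)) :=
  {x | ∀ i, x i ∈ Set.Icc (0 : ℝ) 1}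

/-- The constant `C_{s,d}`: the limit of the minimal `s`-energies of the unit cube, normalized by
`N ^ (1 + s / d)`. -/
noncomputable def cubeConst (s : ℝ) (d : ℕ) : ℝ≥0∞ :=
  limUnder atTop fun N : ℕ => minEnergy s (unitCube d) N / (N : ℝ≥0∞) ^ (1 + s / (d : ℝ))

/-- The normalized counting measure `(1 / |ω|) ∑_{x ∈ ω} δ_x`. -/
noncomputable def countingMeasure {d : ℕ} (ω : Finset (EuclideanSpace ℝ (Fin d))) :
    FiniteMeasure (EuclideanSpace ℝ (Fin d)) :=
  (ω.card : ℝ≥0)⁻¹ • ∑ x ∈ ω, (diracProba x).toFiniteMeasure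

/-- Lebesgue measure restricted to `A` and divided by the measure of `A`. -/
noncomputable def uniformMeasure {d : ℕ} (A : Set (EuclideanSpace ℝ (Fin d))) :
    FiniteMeasure (EuclideanSpace ℝ (Fin d)) :=
  ⟨ProbabilityTheory.cond volume A, inferInstance⟩

end Riesz

/-! Both cases rest on one fact: a configuration of `n` points in a compact `B` has energy at least
`c τ(n) - K` for every `c < C / |B|^t`. For `s > d`, `t = s/d`, `τ(n) = n^(1+t)` and `C = C_{s,d}`;
for `s = d`, `t = 1`, `τ(n) = n² log n` and `C` is the volume of the unit ball. Let `E` have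
boundary null in `A`. Dropping the interactions between `ω_N ∩ E` and `ω_N \ E` and bounding both
parts below, any limit `p` of the proportion in `E` satisfies `C p^(1+t)/v₁^t + C (1-p)^(1+t)/v₂^t ≤
C/(v₁+v₂)^t` if `v₁, v₂ > 0`, where `v₁ = |A ∩ E|` and `v₂ = |A \ E|`. Strict convexity forces `p =
v₁/(v₁+v₂)` (`eq_div_of_forall_add_le`); null volumes are handled directly. The portmanteau theorem
concludes (`tendsto_countingMeasure`). For `s > d` the lower bound comes from covering `B` by small
cubes, discarding interactions between cubes and applying the power mean inequality
(`exists_rpow_card_le_energy_add`). The limit `C_{s,d}` exists because separated copies of a good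
configuration interact negligibly (`minEnergy_unitCube_mul_le`); it is positive by pigeonhole. For
`s = d`, `|x|^(-d)` is an average over scales of overlap volumes of two unit balls. At each scale
Cauchy–Schwarz bounds the overlap sum below, and integrating over scales yields the logarithm
(`sq_card_mul_log_le_energy_add`). -/

namespace Riesz

/-! ### Elementary properties of energy: monotonicity, splitting, scaling. -/

section EnergyBasics

variable {d : ℕ}

open Classical in
/-- The energy as a sum over the ordered pairs of distinct points. -/
lemma energy_eq_sum_offDiag (s : ℝ) (ω : Finset (EuclideanSpace ℝ (Fin d))) :
    energy s ω = ∑ p ∈ ω.offDiag, 1 / edist p.1 p.2 ^ s := by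
  have h : ω.offDiag = (ω ×ˢ ω).filter (fun p => p.1 ≠ p.2) := by
    ext p; simp [Finset.mem_offDiag, and_assoc]
  rw [h, Finset.sum_filter, Finset.sum_product_right, energy]
  refine Finset.sum_congr rfl fun y _ => ?_
  rw [← Finset.sum_filter]
  refine Finset.sum_congr ?_ fun _ _ => rfl
  ext x; simp [and_comm]

open Classical in
lemma energy_eq_sum_ite (s : ℝ) (ω : Finset (EuclideanSpace ℝ (Fin d))) :
    energy s ω = ∑ y ∈ ω, ∑ x ∈ ω, if x = y then 0 else 1 / edist x y ^ s := by
  rw [energy]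
  refine Finset.sum_congr rfl fun y _ => ?_
  rw [Finset.sum_ite, Finset.sum_const_zero, zero_add]
  refine Finset.sum_congr ?_ fun _ _ => rfl
  ext x; simp [and_comm]

lemma energy_mono (s : ℝ) {ω ω' : Finset (EuclideanSpace ℝ (Fin d))} (h : ω ⊆ ω') :
    energy s ω ≤ energy s ω' := by
  classical
  rw [energy_eq_sum_offDiag, energy_eq_sum_offDiag]
  exact Finset.sum_le_sum_of_subset (Finset.offDiag_mono h)

/-- Dropping the interactions between different classes of points only lowers the energy. -/
lemma sum_energy_fiber_le {ι : Type*} [DecidableEq ι] (s : ℝ)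
    (ω : Finset (EuclideanSpace ℝ (Fin d))) (f : EuclideanSpace ℝ (Fin d) → ι) (I : Finset ι) :
    ∑ i ∈ I, energy s (ω.filter fun x => f x = i) ≤ energy s ω := by
  classical
  simp only [energy_eq_sum_offDiag]
  rw [← Finset.sum_biUnion]
  · refine Finset.sum_le_sum_of_subset fun p hp => ?_
    simp only [Finset.mem_biUnion, Finset.mem_offDiag, Finset.mem_filter] at hp
    obtain ⟨i, -, h1, h2, h3⟩ := hp
    exact Finset.mem_offDiag.2 ⟨h1.1, h2.1, h3⟩
  · intro i _ j _ hij
    refine Finset.disjoint_left.2 fun p hp hp' => hij ?_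
    simp only [Finset.mem_offDiag, Finset.mem_filter] at hp hp'
    rw [← hp.1.2, hp'.1.2]

open Classical in
lemma energy_filter_add_le (s : ℝ) (ω : Finset (EuclideanSpace ℝ (Fin d)))
    (B : Set (EuclideanSpace ℝ (Fin d))) :
    energy s (ω.filter (· ∈ B)) + energy s (ω.filter (· ∉ B)) ≤ energy s ω := by
  have h := sum_energy_fiber_le s ω (fun x => x ∈ B) {True, False}
  rw [Finset.sum_pair (by simp)] at h
  simpa using h

open Classical in
lemma energy_image_of_edist_eq (s : ℝ) {r : ℝ≥0∞} (hr : r ≠ 0) (hr' : r ≠ ∞)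
    (ω : Finset (EuclideanSpace ℝ (Fin d)))
    {f : EuclideanSpace ℝ (Fin d) → EuclideanSpace ℝ (Fin d)}
    (hf : ∀ x y, edist (f x) (f y) = r * edist x y) :
    energy s (ω.image f) = r ^ (-s) * energy s ω := by
  have hinj : Function.Injective f := fun x y hxy => by
    have := hf x y
    rw [hxy, edist_self, eq_comm, mul_eq_zero] at this
    exact edist_eq_zero.1 (this.resolve_left hr)
  have him : (ω.image f).offDiag = ω.offDiag.image (Prod.map f f) := by
    ext ⟨a, b⟩
    simp only [Finset.mem_offDiag, Finset.mem_image, Prod.exists, Prod.map_apply, Prod.mk.injEq]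
    constructor
    · rintro ⟨⟨x, hx, rfl⟩, ⟨y, hy, rfl⟩, h⟩
      exact ⟨x, y, ⟨hx, hy, fun e => h (by rw [e])⟩, rfl, rfl⟩
    · rintro ⟨x, y, ⟨hx, hy, h⟩, rfl, rfl⟩
      exact ⟨⟨x, hx, rfl⟩, ⟨y, hy, rfl⟩, fun e => h (hinj e)⟩
  rw [energy_eq_sum_offDiag, energy_eq_sum_offDiag, him,
    Finset.sum_image (fun p _ q _ h => (hinj.prodMap hinj) h), Finset.mul_sum]
  refine Finset.sum_congr rfl fun p _ => ?_
  rw [Prod.map_fst, Prod.map_snd, hf, ENNReal.mul_rpow_of_ne_top hr' (edist_ne_top _ _),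
    one_div, one_div, ENNReal.mul_inv (Or.inl ?_) (Or.inl ?_), ENNReal.rpow_neg]
  · simp [hr, hr']
  · simp [hr, hr']

lemma minEnergy_le {s : ℝ} {A : Set (EuclideanSpace ℝ (Fin d))}
    {ω : Finset (EuclideanSpace ℝ (Fin d))} (h : (ω : Set _) ⊆ A) :
    minEnergy s A ω.card ≤ energy s ω :=
  iInf₂_le ω ⟨rfl, h⟩

lemma minEnergy_mono (s : ℝ) (A : Set (EuclideanSpace ℝ (Fin d))) :
    Monotone (minEnergy s A) := by
  intro M N hMN
  refine le_iInf₂ fun ω hω => ?_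
  obtain ⟨ω', h1, h2⟩ := Finset.exists_subset_card_eq (hMN.trans hω.1.ge)
  calc minEnergy s A M = minEnergy s A ω'.card := by rw [h2]
    _ ≤ energy s ω' := minEnergy_le fun x hx => hω.2 (h1 hx)
    _ ≤ energy s ω := energy_mono s h1

/-- The closed cube of side `h` with lower corner `h • k`. -/
def gridCube (h : ℝ) (k : Fin d → ℤ) : Set (EuclideanSpace ℝ (Fin d)) :=
  {x | ∀ i, x i ∈ Set.Icc (h * k i) (h * (k i + 1))}

lemma edist_smul_add {r : ℝ} (hr : 0 < r) (a x y : EuclideanSpace ℝ (Fin d)) :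
    edist (r • x + a) (r • y + a) = ENNReal.ofReal r * edist x y := by
  rw [edist_add_right, edist_smul₀, ENNReal.smul_def, smul_eq_mul, ENNReal.ofReal,
    Real.toNNReal_eq_nnnorm_of_nonneg hr.le]

lemma minEnergy_unitCube_le_of_subset_gridCube (s : ℝ) {h : ℝ} (hh : 0 < h) (k : Fin d → ℤ)
    {ω : Finset (EuclideanSpace ℝ (Fin d))} (hω : (ω : Set _) ⊆ gridCube h k) :
    ENNReal.ofReal h ^ (-s) * minEnergy s (unitCube d) ω.card ≤ energy s ω := by
  classical
  set f : EuclideanSpace ℝ (Fin d) → EuclideanSpace ℝ (Fin d) :=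
    fun x => h⁻¹ • x + WithLp.toLp 2 (fun i => -(k i : ℝ)) with hf
  have hr : ENNReal.ofReal h ≠ 0 := by simpa using hh
  have hfd : ∀ x y, edist (f x) (f y) = (ENNReal.ofReal h)⁻¹ * edist x y := fun x y => by
    rw [hf]; simp only
    rw [edist_smul_add (inv_pos.2 hh), ENNReal.ofReal_inv_of_pos hh]
  have hinj : Function.Injective f := fun x y hxy => by
    have := hfd x y
    rw [hxy, edist_self, eq_comm, mul_eq_zero] at this
    exact edist_eq_zero.1 (this.resolve_left (by simp))
  have hE := energy_image_of_edist_eq s (by simp) (by simpa using hh) ω hfd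
  have hsub : ((ω.image f : Finset _) : Set _) ⊆ unitCube d := by
    intro y hy
    obtain ⟨x, hx, rfl⟩ := Finset.mem_image.1 (Finset.mem_coe.1 hy)
    intro i
    have := hω hx i
    simp only [hf, PiLp.add_apply, PiLp.smul_apply, smul_eq_mul]
    constructor
    · have := mul_le_mul_of_nonneg_left this.1 (inv_pos.2 hh).le
      rw [inv_mul_cancel_left₀ hh.ne'] at this
      linarith
    · have := mul_le_mul_of_nonneg_left this.2 (inv_pos.2 hh).le
      rw [inv_mul_cancel_left₀ hh.ne'] at this
      linarith
  have h1 := minEnergy_le (s := s) hsub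
  rw [Finset.card_image_of_injective _ hinj, hE, ENNReal.inv_rpow] at h1
  calc ENNReal.ofReal h ^ (-s) * minEnergy s (unitCube d) ω.card
      ≤ ENNReal.ofReal h ^ (-s) * ((ENNReal.ofReal h ^ (-s))⁻¹ * energy s ω) := by gcongr
    _ = energy s ω := by
      rw [← mul_assoc, ENNReal.mul_inv_cancel, one_mul] <;> simp [hh]

end EnergyBasics

/-! ### Convergence of the lattice sum. -/

section Lattice

variable {d : ℕ}

/-- The lattice sum `∑_{k ∈ ℤ^d, k ≠ 0} ‖k‖_∞ ^ (-s)`. -/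
noncomputable def latticeSum (s : ℝ) (d : ℕ) : ℝ≥0∞ :=
  ∑' k : Fin d → ℤ, if k = 0 then 0 else ENNReal.ofReal ‖k‖ ^ (-s)

/-- The integer vectors form a lattice of rank `d`, over which `‖·‖^(-s)` is summable for `s > d`.
-/
lemma latticeSum_lt_top {s : ℝ} (hs : (d : ℝ) < s) : latticeSum s d < ∞ := by
  classical
  let b := Pi.basisFun ℝ (Fin d)
  let Λ := Submodule.span ℤ (Set.range b)
  have hfin : Module.finrank ℤ Λ = d := by
    rw [Module.finrank_eq_card_basis (b.restrictScalars ℤ), Fintype.card_fin]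
  have hsum := ZLattice.summable_norm_rpow Λ (-s) (by rw [hfin]; linarith)
  have hmem : ∀ k : Fin d → ℤ, (fun i => (k i : ℝ)) ∈ Λ := fun k => by
    have : (fun i => (k i : ℝ)) = ∑ i, k i • b i := by
      ext j
      simp [b, Pi.single_apply]
    rw [this]
    exact Submodule.sum_mem _ fun i _ => Submodule.smul_mem _ _ (Submodule.subset_span ⟨i, rfl⟩)
  let F : (Fin d → ℤ) → Λ := fun k => ⟨_, hmem k⟩
  have hF : Function.Injective F := fun k k' h => by
    have := congrArg Subtype.val h
    ext i
    have hi : (k i : ℝ) = k' i := congrFun this i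
    exact_mod_cast hi
  have hnorm : ∀ k, ‖F k‖ = ‖k‖ := fun k => by
    change ‖fun i => (k i : ℝ)‖ = ‖k‖
    rw [Pi.norm_def, Pi.norm_def]
    congr 2
  have h2 : Summable fun k : Fin d → ℤ => ‖k‖ ^ (-s) := by
    refine (hsum.comp_injective hF).congr fun k => ?_
    rw [Function.comp_apply, hnorm]
  calc latticeSum s d ≤ ∑' k : Fin d → ℤ, ENNReal.ofReal (‖k‖ ^ (-s)) := by
        refine ENNReal.tsum_le_tsum fun k => ?_
        split_ifs with h
        · simp
        · rw [ENNReal.ofReal_rpow_of_pos (norm_pos_iff.2 h)]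
    _ < ∞ := h2.tsum_ofReal_lt_top

end Lattice

/-! ### Filling the cube with separated copies of a configuration. -/

section Subadditivity

variable {d : ℕ}

/-- The point `(j + γ x) / m`, where `j` runs over the cells of the partition of the unit cube
into `m ^ d` equal cubes. -/
noncomputable def cellPoint (m : ℕ) (γ : ℝ) (p : (Fin d → Fin m) × EuclideanSpace ℝ (Fin d)) :
    EuclideanSpace ℝ (Fin d) :=
  (γ / m) • p.2 + (WithLp.toLp 2 fun i => ((p.1 i : ℕ) : ℝ) / m)

lemma cellPoint_mem_unitCube {m : ℕ} (hm : 0 < m) {γ : ℝ} (h0 : 0 < γ) (h1 : γ < 1)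
    (p : (Fin d → Fin m) × EuclideanSpace ℝ (Fin d)) (hp : p.2 ∈ unitCube d) :
    cellPoint m γ p ∈ unitCube d := by
  intro i
  have hi := hp i
  have hj : ((p.1 i : ℕ) : ℝ) + 1 ≤ m := by exact_mod_cast (p.1 i).2
  have hm' : (0 : ℝ) < m := by exact_mod_cast hm
  have : cellPoint m γ p i = (γ * p.2 i + (p.1 i : ℕ)) / m := by
    simp [cellPoint]; ring
  rw [this]
  have hj0 : (0 : ℝ) ≤ ((p.1 i : ℕ) : ℝ) := by positivity
  constructor
  · have := hi.1
    positivity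
  · rw [div_le_one hm']
    nlinarith [hi.1, hi.2]

lemma edist_cellPoint_same {m : ℕ} (hm : 0 < m) {γ : ℝ} (h0 : 0 < γ) (j : Fin d → Fin m)
    (x y : EuclideanSpace ℝ (Fin d)) :
    edist (cellPoint m γ (j, x)) (cellPoint m γ (j, y)) = ENNReal.ofReal (γ / m) * edist x y :=
  edist_smul_add (div_pos h0 (by exact_mod_cast hm)) _ _ _

/-- The difference of two cell indices as an integer vector. -/
def cellDiff {m : ℕ} (j j' : Fin d → Fin m) : Fin d → ℤ :=
  fun i => ((j' i : ℕ) : ℤ) - ((j i : ℕ) : ℤ)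

lemma cellDiff_injective {m : ℕ} (j : Fin d → Fin m) : Function.Injective (cellDiff j) := by
  intro a b h
  ext i
  have := congrFun h i
  simp only [cellDiff] at this
  lia

lemma cellDiff_self {m : ℕ} (j : Fin d → Fin m) : cellDiff j j = 0 := by
  ext i; simp [cellDiff]

lemma cellDiff_ne_zero {m : ℕ} {j j' : Fin d → Fin m} (h : j ≠ j') : cellDiff j j' ≠ 0 :=
  fun e => h (cellDiff_injective j (by rw [e, cellDiff_self]))

/-- In a coordinate where `|cellDiff j j'|` is maximal, the corners differ by `‖cellDiff j j'‖ / m`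
and the points move this by at most `γ / m`; the norm is an integer `≥ 1`, so `‖k‖ - γ ≥ (1 - γ)
‖k‖`. -/
lemma le_edist_cellPoint {m : ℕ} (hm : 0 < m) {γ : ℝ} (h0 : 0 < γ) (h1 : γ < 1)
    {j j' : Fin d → Fin m} (hj : j ≠ j') {x y : EuclideanSpace ℝ (Fin d)}
    (hx : x ∈ unitCube d) (hy : y ∈ unitCube d) :
    ENNReal.ofReal ((1 - γ) / m) * ENNReal.ofReal ‖cellDiff j j'‖ ≤
      edist (cellPoint m γ (j, x)) (cellPoint m γ (j', y)) := by
  have hm' : (0 : ℝ) < m := by exact_mod_cast hm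
  have hk := cellDiff_ne_zero hj
  rw [← ENNReal.ofReal_mul (div_nonneg (by linarith) hm'.le), edist_dist]
  refine ENNReal.ofReal_le_ofReal ?_
  have hpos : 0 < ‖cellDiff j j'‖ := norm_pos_iff.2 hk
  obtain ⟨i, hi⟩ : ∃ i, ‖cellDiff j j' i‖ = ‖cellDiff j j'‖ := by
    by_contra! hne
    have : ‖cellDiff j j'‖ < ‖cellDiff j j'‖ :=
      (pi_norm_lt_iff hpos).2 fun i => lt_of_le_of_ne (norm_le_pi_norm _ i) (hne i)
    exact lt_irrefl _ this
  have hone : (1 : ℝ) ≤ ‖cellDiff j j' i‖ := by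
    have : cellDiff j j' i ≠ 0 := fun e => by rw [e, norm_zero] at hi; exact hpos.ne hi
    rw [Int.norm_eq_abs]
    exact_mod_cast Int.one_le_abs this
  rw [← hi]
  refine le_trans ?_ (PiLp.norm_apply_le (cellPoint m γ (j, x) - cellPoint m γ (j', y)) i |>.trans
    (dist_eq_norm _ _).ge)
  have e : (cellPoint m γ (j, x) - cellPoint m γ (j', y)) i =
      (γ * (x i - y i) - (cellDiff j j' i : ℝ)) / m := by
    simp [cellPoint, cellDiff]; ring
  rw [e, Real.norm_eq_abs, abs_div, abs_of_pos hm', div_mul_eq_mul_div]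
  gcongr
  have hxy : |γ * (x i - y i)| ≤ γ := by
    rw [abs_mul, abs_of_pos h0]
    have : |x i - y i| ≤ 1 := by
      have := hx i; have := hy i
      rw [abs_le]; constructor <;> simp only [Set.mem_Icc] at * <;> linarith
    nlinarith
  have h3 := abs_sub_abs_le_abs_sub (cellDiff j j' i : ℝ) (γ * (x i - y i))
  rw [abs_sub_comm] at h3
  rw [Int.norm_eq_abs] at hone ⊢
  nlinarith

/-- Pairs in the same cell reproduce the scaled energy of one copy; pairs in different cells are
bounded by the lattice sum over cell differences. -/
lemma minEnergy_unitCube_mul_le {s : ℝ} (hs0 : 0 < s) {m : ℕ} (hm : 0 < m) (N : ℕ) {γ : ℝ}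
    (h0 : 0 < γ) (h1 : γ < 1) :
    minEnergy s (unitCube d) (m ^ d * N) ≤
      (m : ℝ≥0∞) ^ d * (ENNReal.ofReal (γ / m) ^ (-s) * minEnergy s (unitCube d) N) +
        (m : ℝ≥0∞) ^ d * ((N : ℝ≥0∞) ^ 2 *
          (ENNReal.ofReal ((1 - γ) / m) ^ (-s) * latticeSum s d)) := by
  classical
  have hm' : (0 : ℝ) < m := by exact_mod_cast hm
  have hγ : ENNReal.ofReal (γ / m) ≠ 0 := by simpa using div_pos h0 hm'
  have hγ' : ENNReal.ofReal ((1 - γ) / m) ≠ 0 := by simpa using div_pos (by linarith) hm'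
  -- The coefficient of the minimal energy is finite and nonzero, so the inequality can be solved
  -- for it and checked on each competitor of the infimum.
  suffices H : ∀ ω : Finset (EuclideanSpace ℝ (Fin d)), ω.card = N ∧ (ω : Set _) ⊆ unitCube d →
      minEnergy s (unitCube d) (m ^ d * N) ≤
      (m : ℝ≥0∞) ^ d * (ENNReal.ofReal (γ / m) ^ (-s) * energy s ω) +
        (m : ℝ≥0∞) ^ d * ((N : ℝ≥0∞) ^ 2 *
          (ENNReal.ofReal ((1 - γ) / m) ^ (-s) * latticeSum s d)) by
    rw [← mul_assoc]
    have ha : (m : ℝ≥0∞) ^ d * ENNReal.ofReal (γ / m) ^ (-s) ≠ ∞ := by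
      refine ENNReal.mul_ne_top (by simp) ?_
      simp [hγ]
    have ha0 : (m : ℝ≥0∞) ^ d * ENNReal.ofReal (γ / m) ^ (-s) ≠ 0 :=
      mul_ne_zero (pow_ne_zero _ (by exact_mod_cast hm.ne')) (by simp [hs0.not_gt])
    rw [← tsub_le_iff_right, mul_comm (_ * _) (minEnergy _ _ _), ← ENNReal.div_le_iff ha0 ha]
    refine le_iInf₂ fun ω hω => ?_
    rw [ENNReal.div_le_iff ha0 ha, tsub_le_iff_right, mul_comm (energy _ _), mul_assoc]
    exact H ω hω
  rintro ω ⟨hcard, hω⟩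
  let P : Finset ((Fin d → Fin m) × EuclideanSpace ℝ (Fin d)) := Finset.univ ×ˢ ω
  have hinj : Set.InjOn (cellPoint m γ) (P : Set ((Fin d → Fin m) × EuclideanSpace ℝ (Fin d))) := by
    rintro ⟨j, x⟩ hx ⟨j', y⟩ hy hxy
    have hx' : x ∈ ω := (Finset.mem_product.1 (Finset.mem_coe.1 hx)).2
    have hy' : y ∈ ω := (Finset.mem_product.1 (Finset.mem_coe.1 hy)).2
    by_cases hj : j = j'
    · subst hj
      have := edist_cellPoint_same hm h0 j x y
      rw [hxy, edist_self, eq_comm, mul_eq_zero] at this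
      rw [edist_eq_zero.1 (this.resolve_left hγ)]
    · have := le_edist_cellPoint hm h0 h1 hj (hω hx') (hω hy')
      rw [hxy, edist_self, nonpos_iff_eq_zero, mul_eq_zero] at this
      have := this.resolve_left hγ'
      exact absurd this (by simpa using cellDiff_ne_zero hj)
  let ω' := P.image (cellPoint m γ)
  have hc' : ω'.card = m ^ d * N := by
    rw [Finset.card_image_of_injOn hinj, Finset.card_product, hcard]
    simp
  have hω' : (ω' : Set _) ⊆ unitCube d := by
    intro z hz
    obtain ⟨p, hp, rfl⟩ := Finset.mem_image.1 (Finset.mem_coe.1 hz)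
    exact cellPoint_mem_unitCube hm h0 h1 p (hω (Finset.mem_product.1 hp).2)
  rw [← hc']
  refine (minEnergy_le hω').trans ?_
  let T : (Fin d → ℤ) → ℝ≥0∞ := fun k => if k = 0 then 0 else ENNReal.ofReal ‖k‖ ^ (-s)
  let K : EuclideanSpace ℝ (Fin d) → EuclideanSpace ℝ (Fin d) → ℝ≥0∞ :=
    fun x y => if x = y then 0 else 1 / edist x y ^ s
  have hterm : ∀ p ∈ P, ∀ q ∈ P,
      (if cellPoint m γ q = cellPoint m γ p then 0 else
        1 / edist (cellPoint m γ q) (cellPoint m γ p) ^ s) ≤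
      (if q.1 = p.1 then ENNReal.ofReal (γ / m) ^ (-s) * K q.2 p.2 else 0) +
        ENNReal.ofReal ((1 - γ) / m) ^ (-s) * T (cellDiff p.1 q.1) := by
    rintro ⟨j, y⟩ hp ⟨j', x⟩ hq
    have hy : y ∈ ω := (Finset.mem_product.1 hp).2
    have hx : x ∈ ω := (Finset.mem_product.1 hq).2
    by_cases hj : j' = j
    · subst hj
      refine le_trans ?_ le_self_add
      rw [if_pos rfl]
      by_cases hxy : x = y
      · simp [hxy]
      · simp only [K, if_neg hxy]
        split_ifs
        · exact zero_le
        · rw [edist_cellPoint_same hm h0, ENNReal.mul_rpow_of_nonneg _ _ hs0.le, one_div, one_div,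
            ENNReal.mul_inv (Or.inl (by simp [hγ, hs0])) (Or.inl (by simp [hs0, hγ])),
            ENNReal.rpow_neg]
    · refine le_trans ?_ le_add_self
      simp only [T, if_neg (cellDiff_ne_zero (Ne.symm hj))]
      split_ifs
      · exact zero_le
      · rw [← ENNReal.mul_rpow_of_ne_top (by simp) (by simp), ENNReal.rpow_neg, one_div, edist_comm]
        refine ENNReal.inv_le_inv.2 (ENNReal.rpow_le_rpow ?_ hs0.le)
        exact le_edist_cellPoint hm h0 h1 (Ne.symm hj) (hω hy) (hω hx)
  have hT : ∀ j : Fin d → Fin m, ∑ j', T (cellDiff j j') ≤ latticeSum s d := fun j => by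
    rw [← tsum_fintype (L := .unconditional _) (fun j' => T (cellDiff j j'))]
    exact ENNReal.tsum_comp_le_tsum_of_injective (cellDiff_injective j) T
  rw [energy_eq_sum_ite]
  simp only [ω', Finset.sum_image hinj]
  refine (Finset.sum_le_sum fun p hp => Finset.sum_le_sum fun q hq => hterm p hp q hq).trans ?_
  simp_rw [Finset.sum_add_distrib]
  refine add_le_add (le_of_eq ?_) ?_
  · simp only [P, Finset.sum_product]
    simp only [Finset.sum_ite_irrel, Finset.sum_const_zero, Finset.sum_ite_eq', Finset.mem_univ,
      if_true, Finset.sum_const, Finset.card_univ]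
    rw [energy_eq_sum_ite]
    simp only [← Finset.mul_sum, K]
    simp
  · simp only [P, Finset.sum_product]
    calc ∑ j : Fin d → Fin m, ∑ _y ∈ ω, ∑ j' : Fin d → Fin m, ∑ _x ∈ ω,
          ENNReal.ofReal ((1 - γ) / m) ^ (-s) * T (cellDiff j j')
        = ∑ j : Fin d → Fin m, (N : ℝ≥0∞) ^ 2 * (ENNReal.ofReal ((1 - γ) / m) ^ (-s) *
            ∑ j', T (cellDiff j j')) := by
          refine Finset.sum_congr rfl fun j _ => ?_
          simp only [Finset.sum_const, hcard, nsmul_eq_mul, ← Finset.mul_sum]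
          ring
      _ ≤ ∑ j : Fin d → Fin m, (N : ℝ≥0∞) ^ 2 * (ENNReal.ofReal ((1 - γ) / m) ^ (-s) *
            latticeSum s d) := by
          gcongr with j
          exact hT j
      _ = _ := by simp

end Subadditivity

/-! ### Existence and finiteness of the limit for the cube. -/

section CubeLimit

variable {d : ℕ}

/-- The bound for `minEnergy s (unitCube d) M / M ^ (1 + s / d)` with large `M` that comes from
the copies of an `N`-point configuration. -/
noncomputable def copyBound (s : ℝ) (d : ℕ) (γ : ℝ) (N : ℕ) : ℝ≥0∞ :=
  ENNReal.ofReal γ ^ (-s) * (minEnergy s (unitCube d) N / (N : ℝ≥0∞) ^ (1 + s / (d : ℝ))) +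
    ENNReal.ofReal (1 - γ) ^ (-s) * latticeSum s d * (N : ℝ≥0∞) ^ (1 - s / (d : ℝ))

/-- After normalization `m` drops out, and the `N²` interactions between two cells leave the factor
`N^(1 - s/d)`, which vanishes as `N → ∞` when `s > d`. -/
lemma minEnergy_unitCube_mul_le_copyBound (hd : 1 ≤ d) {s : ℝ} (hs0 : 0 < s) {m : ℕ} (hm : 0 < m)
    {N : ℕ} (hN : 0 < N) {γ : ℝ} (h0 : 0 < γ) (h1 : γ < 1) :
    minEnergy s (unitCube d) (m ^ d * N) ≤
      copyBound s d γ N * ((m : ℝ≥0∞) ^ d * N) ^ (1 + s / (d : ℝ)) := by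
  have hd' : (d : ℝ) ≠ 0 := by positivity
  have hm0 : (m : ℝ≥0∞) ≠ 0 := by exact_mod_cast hm.ne'
  have hN0 : (N : ℝ≥0∞) ≠ 0 := by exact_mod_cast hN.ne'
  have hmt : (m : ℝ≥0∞) ≠ ∞ := by simp
  have hNt : (N : ℝ≥0∞) ≠ ∞ := by simp
  have hdiv : ∀ {r : ℝ}, 0 < r → ENNReal.ofReal (r / m) ^ (-s) =
      ENNReal.ofReal r ^ (-s) * (m : ℝ≥0∞) ^ s := fun {r} hr => by
    rw [ENNReal.ofReal_div_of_pos (by exact_mod_cast hm), ENNReal.ofReal_natCast, div_eq_mul_inv,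
      ENNReal.mul_rpow_of_ne_top (by simp) (by simp [hm0]), ENNReal.inv_rpow,
      ENNReal.rpow_neg (m : ℝ≥0∞), inv_inv]
  refine (minEnergy_unitCube_mul_le hs0 hm N h0 h1).trans (le_of_eq ?_)
  have e1 : ((m : ℝ≥0∞) ^ d * N) ^ (1 + s / (d : ℝ)) =
      (m : ℝ≥0∞) ^ d * (m : ℝ≥0∞) ^ s * (N : ℝ≥0∞) ^ (1 + s / (d : ℝ)) := by
    rw [ENNReal.mul_rpow_of_nonneg _ _ (by positivity), ← ENNReal.rpow_natCast, ← ENNReal.rpow_mul,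
      ← ENNReal.rpow_add _ _ hm0 hmt]
    congr 2
    field_simp
  have e2 : (N : ℝ≥0∞) ^ (1 - s / (d : ℝ)) * (N : ℝ≥0∞) ^ (1 + s / (d : ℝ)) =
      (N : ℝ≥0∞) ^ 2 := by
    rw [← ENNReal.rpow_add _ _ hN0 hNt, ← ENNReal.rpow_natCast]
    congr 1
    push_cast; ring
  have e3 : minEnergy s (unitCube d) N / (N : ℝ≥0∞) ^ (1 + s / (d : ℝ)) *
      (N : ℝ≥0∞) ^ (1 + s / (d : ℝ)) = minEnergy s (unitCube d) N := by
    refine ENNReal.div_mul_cancel (by simp [hN0]) ?_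
    exact ENNReal.rpow_ne_top_of_nonneg (by positivity) hNt
  rw [copyBound, e1, add_mul, hdiv h0, hdiv (sub_pos.2 h1), ← e2]
  conv_lhs => rw [← e3]
  ring

/-- A general `M` is rounded up to `m^d * N` with `m = ⌈(M/N)^(1/d)⌉`; minimal energy is monotone in
the number of points, and the relative loss tends to 0. -/
lemma limsup_minEnergy_unitCube_le (hd : 1 ≤ d) {s : ℝ} (hs0 : 0 < s) {N : ℕ} (hN : 0 < N)
    {γ : ℝ} (h0 : 0 < γ) (h1 : γ < 1) :
    limsup (fun M : ℕ => minEnergy s (unitCube d) M / (M : ℝ≥0∞) ^ (1 + s / (d : ℝ))) atTop ≤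
      copyBound s d γ N := by
  have hd' : (d : ℝ) ≠ 0 := by positivity
  have hN' : (0 : ℝ) < N := by exact_mod_cast hN
  -- `ρ M` dominates `(m^d N / M)^(1 + s/d)`: with `u = (M/N)^(1/d)`, `⌈u⌉ ≤ (1 + u⁻¹) u`.
  set ρ : ℕ → ℝ≥0∞ := fun M =>
    ENNReal.ofReal ((1 + ((N : ℝ) / M) ^ (1 / (d : ℝ))) ^ d) ^ (1 + s / (d : ℝ))
  have hρ : Tendsto (fun M => copyBound s d γ N * ρ M) atTop (𝓝 (copyBound s d γ N)) := by
    have h2 : Tendsto (fun M : ℕ => (N : ℝ) / M) atTop (𝓝 0) :=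
      tendsto_const_div_atTop_nhds_zero_nat _
    have h3 : Tendsto (fun M : ℕ => ((N : ℝ) / M) ^ (1 / (d : ℝ))) atTop (𝓝 0) := by
      have := h2.rpow_const (p := 1 / (d : ℝ)) (Or.inr (by positivity))
      rwa [Real.zero_rpow (by positivity)] at this
    have h4 : Tendsto ρ atTop (𝓝 1) := by
      have := (ENNReal.tendsto_ofReal ((h3.const_add 1).pow d)).ennrpow_const (1 + s / (d : ℝ))
      simpa [ρ] using this
    simpa using ENNReal.Tendsto.const_mul h4 (Or.inl one_ne_zero)
  rw [← hρ.limsup_eq]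
  refine limsup_le_limsup ?_
  filter_upwards [eventually_gt_atTop 0] with M hM
  have hM' : (0 : ℝ) < M := by exact_mod_cast hM
  set u : ℝ := ((M : ℝ) / N) ^ (1 / (d : ℝ)) with hu
  have hu0 : 0 < u := by positivity
  have hud : u ^ d = (M : ℝ) / N := by
    rw [hu, ← Real.rpow_natCast, ← Real.rpow_mul (by positivity), one_div_mul_cancel hd',
      Real.rpow_one]
  have hui : ((N : ℝ) / M) ^ (1 / (d : ℝ)) = u⁻¹ := by
    rw [hu, ← Real.inv_rpow (by positivity), inv_div]
  set m := ⌈u⌉₊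
  have hm : 0 < m := Nat.ceil_pos.2 hu0
  have hMm : M ≤ m ^ d * N := by
    have : (M : ℝ) ≤ m ^ d * N := by
      rw [← div_le_iff₀ hN', ← hud]
      gcongr
      exact Nat.le_ceil u
    exact_mod_cast this
  have hmM : (m : ℝ) ^ d * N ≤ (1 + ((N : ℝ) / M) ^ (1 / (d : ℝ))) ^ d * M := by
    have h5 : (m : ℝ) ≤ (1 + u⁻¹) * u := by
      rw [add_mul, inv_mul_cancel₀ hu0.ne']
      linarith [Nat.ceil_lt_add_one hu0.le]
    have h6 : (M : ℝ) = u ^ d * N := by rw [hud]; field_simp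
    rw [hui, h6, ← mul_assoc, ← mul_pow]
    gcongr
  have hM0 : (M : ℝ≥0∞) ≠ 0 := by exact_mod_cast hM.ne'
  refine ENNReal.div_le_of_le_mul ?_
  calc minEnergy s (unitCube d) M ≤ minEnergy s (unitCube d) (m ^ d * N) := minEnergy_mono _ _ hMm
    _ ≤ copyBound s d γ N * ((m : ℝ≥0∞) ^ d * N) ^ (1 + s / (d : ℝ)) :=
      minEnergy_unitCube_mul_le_copyBound hd hs0 hm hN h0 h1
    _ ≤ copyBound s d γ N *
        (ENNReal.ofReal ((1 + ((N : ℝ) / M) ^ (1 / (d : ℝ))) ^ d) * M) ^ (1 + s / (d : ℝ)) := by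
      refine mul_le_mul' le_rfl (ENNReal.rpow_le_rpow ?_ (by positivity))
      have := ENNReal.ofReal_le_ofReal hmM
      rwa [ENNReal.ofReal_mul (by positivity), ENNReal.ofReal_mul (by positivity),
        ENNReal.ofReal_pow (by positivity), ENNReal.ofReal_natCast, ENNReal.ofReal_natCast,
        ENNReal.ofReal_natCast] at this
    _ = _ := by
      rw [ENNReal.mul_rpow_of_nonneg _ _ (by positivity), mul_assoc]

/-- Apply `copyBound` at infinitely many `N` where the quotient is near its liminf: `N → ∞` removes
the lattice term, and then `γ → 1` removes the factor `γ^(-s)`. -/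
lemma minEnergy_unitCube_limsup_le_liminf (hd : 1 ≤ d) {s : ℝ} (hs : (d : ℝ) < s) :
    limsup (fun M : ℕ => minEnergy s (unitCube d) M / (M : ℝ≥0∞) ^ (1 + s / (d : ℝ))) atTop ≤
    liminf (fun M : ℕ => minEnergy s (unitCube d) M / (M : ℝ≥0∞) ^ (1 + s / (d : ℝ))) atTop := by
  have hd' : (0 : ℝ) < d := by exact_mod_cast hd
  have hs0 : 0 < s := hd'.trans hs
  refine le_of_forall_gt fun x hx => ?_
  obtain ⟨y, hy, hyx⟩ := exists_between hx
  have hyt : y ≠ ∞ := (hyx.trans_le le_top).ne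
  refine lt_of_le_of_lt ?_ hyx
  have hfreq := frequently_lt_of_liminf_lt (by isBoundedDefault) hy
  have hγ : ∀ γ : ℝ, 0 < γ → γ < 1 →
      limsup (fun M : ℕ => minEnergy s (unitCube d) M / (M : ℝ≥0∞) ^ (1 + s / (d : ℝ))) atTop ≤
        ENNReal.ofReal γ ^ (-s) * y := by
    intro γ h0 h1
    have ht : Tendsto (fun N : ℕ => ENNReal.ofReal γ ^ (-s) * y +
        ENNReal.ofReal (1 - γ) ^ (-s) * latticeSum s d * (N : ℝ≥0∞) ^ (1 - s / (d : ℝ))) atTop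
        (𝓝 (ENNReal.ofReal γ ^ (-s) * y)) := by
      have h2 : Tendsto (fun N : ℕ => (N : ℝ≥0∞) ^ (1 - s / (d : ℝ))) atTop (𝓝 0) := by
        have := ENNReal.tendsto_nat_nhds_top.ennrpow_const (1 - s / (d : ℝ))
        rwa [ENNReal.top_rpow_of_neg] at this
        rw [sub_neg, one_lt_div hd']; exact hs
      have h3 := ENNReal.Tendsto.const_mul
        (a := ENNReal.ofReal (1 - γ) ^ (-s) * latticeSum s d) h2 (Or.inr ?_)
      · simpa using h3.const_add (ENNReal.ofReal γ ^ (-s) * y)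
      · exact ENNReal.mul_ne_top (by simp [h1]) (latticeSum_lt_top hs).ne
    refine ge_of_tendsto_of_frequently ht ?_
    refine (hfreq.and_eventually (eventually_gt_atTop 0)).mono fun N hN => ?_
    refine (limsup_minEnergy_unitCube_le hd hs0 hN.2 h0 h1).trans ?_
    rw [copyBound]
    gcongr
    exact hN.1.le
  have ht : Tendsto (fun γ : ℝ => ENNReal.ofReal γ ^ (-s) * y) (𝓝[<] 1) (𝓝 y) := by
    have h1 : Tendsto (fun γ : ℝ => ENNReal.ofReal γ ^ (-s)) (𝓝[<] 1) (𝓝 1) := by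
      have := (ENNReal.tendsto_ofReal (tendsto_id (α := ℝ) (x := 𝓝 1))).ennrpow_const (-s)
      simp only [id, ENNReal.ofReal_one, ENNReal.one_rpow] at this
      exact this.mono_left nhdsWithin_le_nhds
    simpa using ENNReal.Tendsto.mul_const h1 (Or.inl one_ne_zero)
  refine ge_of_tendsto ht ?_
  filter_upwards [Ioo_mem_nhdsLT (show (0 : ℝ) < 1 by norm_num)] with γ h
  exact hγ γ h.1 h.2

theorem tendsto_minEnergy_unitCube (hd : 1 ≤ d) {s : ℝ} (hs : (d : ℝ) < s) :
    Tendsto (fun N : ℕ => minEnergy s (unitCube d) N / (N : ℝ≥0∞) ^ (1 + s / (d : ℝ))) atTop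
      (𝓝 (cubeConst s d)) := by
  have h := tendsto_of_le_liminf_of_limsup_le
    (minEnergy_unitCube_limsup_le_liminf hd hs) le_rfl
  -- `limUnder` has meaning only once convergence is known, which `h` supplies.
  rw [cubeConst, h.limUnder_eq]
  exact h

theorem cubeConst_lt_top (hd : 1 ≤ d) {s : ℝ} (hs : (d : ℝ) < s) : cubeConst s d < ∞ := by
  have hd' : (0 : ℝ) < d := by exact_mod_cast hd
  have hs0 : 0 < s := hd'.trans hs
  -- A single point has energy 0, so for `N = 1` only the finite lattice term remains.
  have h := limsup_minEnergy_unitCube_le hd hs0 one_pos (γ := 1 / 2) (by norm_num) (by norm_num)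
  rw [(tendsto_minEnergy_unitCube hd hs).limsup_eq] at h
  refine h.trans_lt ?_
  have h0 : minEnergy s (unitCube d) 1 = 0 := by
    have := minEnergy_le (s := s) (A := unitCube d) (ω := {0}) (by
      simp [unitCube])
    simpa [energy] using this
  rw [copyBound, h0]
  simp only [Nat.cast_one, ENNReal.one_rpow, div_one, mul_zero, zero_add, mul_one]
  refine ENNReal.mul_lt_top ?_ (latticeSum_lt_top hs)
  rw [lt_top_iff_ne_top]
  norm_num

end CubeLimit

/-! ### Grids of small cubes and covers of compact sets. -/

section Grid

variable {d : ℕ}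

/-- The index of the grid cube of side `h` that contains `x`. -/
noncomputable def gridIndex (h : ℝ) (x : EuclideanSpace ℝ (Fin d)) : Fin d → ℤ :=
  fun i => ⌊x i / h⌋

lemma gridIndex_eq_iff {h : ℝ} (hh : 0 < h) {x : EuclideanSpace ℝ (Fin d)} {k : Fin d → ℤ} :
    gridIndex h x = k ↔ ∀ i, x i ∈ Set.Ico (h * k i) (h * (k i + 1)) := by
  simp only [funext_iff, gridIndex, Int.floor_eq_iff, le_div_iff₀ hh, div_lt_iff₀ hh, Set.mem_Ico,
    mul_comm h]

lemma mem_gridCube_gridIndex {h : ℝ} (hh : 0 < h) (x : EuclideanSpace ℝ (Fin d)) :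
    x ∈ gridCube h (gridIndex h x) :=
  fun i => Set.Ico_subset_Icc_self ((gridIndex_eq_iff hh).1 rfl i)

lemma dist_le_of_mem_gridCube {h : ℝ} (hh : 0 < h) {k : Fin d → ℤ}
    {x y : EuclideanSpace ℝ (Fin d)} (hx : x ∈ gridCube h k) (hy : y ∈ gridCube h k) :
    dist x y ≤ h * d := by
  rw [EuclideanSpace.dist_eq]
  refine Real.sqrt_le_iff.2 ⟨by positivity, ?_⟩
  have h1 : ∀ i ∈ Finset.univ, dist (x i) (y i) ^ 2 ≤ h ^ 2 := fun i _ => by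
    have := hx i; have := hy i
    simp only [Set.mem_Icc] at *
    rw [Real.dist_eq, sq_abs]
    refine sq_le_sq' ?_ ?_ <;> linarith
  refine (Finset.sum_le_card_nsmul _ _ _ h1).trans ?_
  rw [Finset.card_univ, Fintype.card_fin, nsmul_eq_mul, mul_pow, mul_comm]
  have : (d : ℝ) ≤ (d : ℝ) ^ 2 := by exact_mod_cast Nat.le_self_pow two_ne_zero d
  gcongr

lemma measurableSet_gridIndex_eq {h : ℝ} (hh : 0 < h) (k : Fin d → ℤ) :
    MeasurableSet {x : EuclideanSpace ℝ (Fin d) | gridIndex h x = k} := by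
  simp only [gridIndex_eq_iff hh, Set.ofPred_forall]
  exact MeasurableSet.iInter fun i => measurableSet_Ico.preimage (by fun_prop)

lemma volume_gridIndex_eq {h : ℝ} (hh : 0 < h) (k : Fin d → ℤ) :
    volume {x : EuclideanSpace ℝ (Fin d) | gridIndex h x = k} = ENNReal.ofReal h ^ d := by
  have e : {x : EuclideanSpace ℝ (Fin d) | gridIndex h x = k} =
      (@WithLp.ofLp 2 (Fin d → ℝ)) ⁻¹'
        (Set.univ.pi fun i => Set.Ico (h * k i) (h * (k i + 1))) := by
    ext x
    simp [gridIndex_eq_iff hh]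
  rw [e, (PiLp.volume_preserving_ofLp (Fin d)).measure_preimage
    (MeasurableSet.univ_pi fun i => measurableSet_Ico).nullMeasurableSet, Real.volume_pi_Ico]
  have : ∀ i, h * ((k i : ℝ) + 1) - h * k i = h := fun i => by ring
  simp [this]

/-- A compact set is covered by finitely many cubes of a fine enough grid, of total volume
arbitrarily close to the volume of the set. -/
lemma exists_grid_cover {B : Set (EuclideanSpace ℝ (Fin d))} (hB : IsCompact B) {v : ℝ≥0∞}
    (hv : volume B < v) (hv' : v ≠ ∞) :
    ∃ h : ℝ, 0 < h ∧ ∃ I : Finset (Fin d → ℤ), (∀ x ∈ B, gridIndex h x ∈ I) ∧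
      (I.card : ℝ≥0∞) * ENNReal.ofReal h ^ d ≤ v := by
  classical
  obtain ⟨U, hBU, hU, hUv⟩ := B.exists_isOpen_lt_of_lt v hv
  obtain ⟨δ, hδ, hδU⟩ := hB.exists_thickening_subset_open hU hBU
  -- Cells have diameter at most `h * d < δ`, so a cell meeting `B` stays inside `U`.
  set h : ℝ := δ / (d + 1) with hh'
  have hh : 0 < h := by positivity
  have hhd : h * d < δ := by
    rw [hh', div_mul_eq_mul_div, div_lt_iff₀ (by positivity)]
    nlinarith
  refine ⟨h, hh, ?_⟩
  set J : Set (Fin d → ℤ) := gridIndex h '' B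
  have hcell : ∀ k ∈ J, {x | gridIndex h x = k} ⊆ U := by
    rintro _ ⟨y, hy, rfl⟩ x hx
    refine hδU (Metric.mem_thickening_iff.2 ⟨y, hy, ?_⟩)
    have hx' := mem_gridCube_gridIndex hh x
    rw [show gridIndex h x = gridIndex h y from hx] at hx'
    exact (dist_le_of_mem_gridCube hh hx' (mem_gridCube_gridIndex hh y)).trans_lt hhd
  -- The half-open cells are disjoint, so their volumes add up inside `U`. The bound is stated for
  -- finite subsets because it is also what makes `J` finite.
  have hcard : ∀ I : Finset (Fin d → ℤ), (I : Set _) ⊆ J →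
      (I.card : ℝ≥0∞) * ENNReal.ofReal h ^ d ≤ v := by
    intro I hI
    calc (I.card : ℝ≥0∞) * ENNReal.ofReal h ^ d
        = ∑ k ∈ I, volume {x : EuclideanSpace ℝ (Fin d) | gridIndex h x = k} := by
          simp [volume_gridIndex_eq hh]
      _ = volume (⋃ k ∈ I, {x : EuclideanSpace ℝ (Fin d) | gridIndex h x = k}) := by
          rw [measure_biUnion_finset]
          · intro k _ k' _ hkk'
            exact Set.disjoint_left.2 fun x hx hx' => hkk' (hx.symm.trans hx')
          · exact fun k _ => measurableSet_gridIndex_eq hh k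
      _ ≤ volume U := measure_mono (Set.iUnion₂_subset fun k hk => hcell k (hI hk))
      _ ≤ v := hUv.le
  have hfin : J.Finite := by
    by_contra hinf
    have hpos : ENNReal.ofReal h ^ d ≠ 0 := by simp [hh]
    obtain ⟨n, hn⟩ := ENNReal.exists_nat_gt (ENNReal.div_ne_top hv' hpos)
    obtain ⟨I, hI, hIn⟩ := Set.Infinite.exists_subset_card_eq hinf n
    have := hcard I hI
    rw [hIn, ← ENNReal.le_div_iff_mul_le (Or.inl hpos) (Or.inr hv')] at this
    exact hn.not_ge this
  refine ⟨hfin.toFinset, fun x hx => ?_, hcard _ (by simp)⟩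
  simpa using ⟨x, hx, rfl⟩

lemma card_eq_sum_card_gridIndex {B : Set (EuclideanSpace ℝ (Fin d))} {h : ℝ}
    {I : Finset (Fin d → ℤ)} (hI : ∀ x ∈ B, gridIndex h x ∈ I)
    {ω : Finset (EuclideanSpace ℝ (Fin d))} (hω : (ω : Set _) ⊆ B) :
    ω.card = ∑ k ∈ I, (ω.filter fun x => gridIndex h x = k).card :=
  Finset.card_eq_sum_card_fiberwise fun x hx => hI x (hω hx)

end Grid

/-! ### Positivity of the constant by pigeonhole. -/

section Positivity

variable {d : ℕ}

/-- With at least two points, each has a neighbour within `D`; the extra `D ^ (-s)` pays for a lone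
point. -/
lemma rpow_mul_card_le_energy_add {s : ℝ} (hs0 : 0 < s) {D : ℝ≥0∞}
    {ω : Finset (EuclideanSpace ℝ (Fin d))} (hω : ∀ x ∈ ω, ∀ y ∈ ω, edist x y ≤ D) :
    D ^ (-s) * ω.card ≤ energy s ω + D ^ (-s) := by
  classical
  rcases le_or_gt ω.card 1 with h | h
  · calc D ^ (-s) * ω.card ≤ D ^ (-s) * 1 := by gcongr; exact_mod_cast h
      _ ≤ _ := by rw [mul_one]; exact le_add_self
  · refine le_trans ?_ le_self_add
    rw [energy, mul_comm, ← nsmul_eq_mul, ← Finset.sum_const]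
    refine Finset.sum_le_sum fun y hy => ?_
    obtain ⟨x, hx, hxy⟩ := Finset.exists_mem_ne h y
    refine le_trans ?_ (Finset.single_le_sum (f := fun x => 1 / edist x y ^ s)
      (fun _ _ => zero_le) (Finset.mem_erase.2 ⟨hxy, hx⟩))
    rw [ENNReal.rpow_neg, one_div]
    exact ENNReal.inv_le_inv.2 (ENNReal.rpow_le_rpow (hω x hx y hy) hs0.le)

lemma le_minEnergy_unitCube (hd : 1 ≤ d) {s : ℝ} (hs0 : 0 < s) {p : ℕ} (hp : 2 ≤ p) :
    ENNReal.ofReal (2 / p * d) ^ (-s) * (p : ℝ≥0∞) ^ d ≤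
      minEnergy s (unitCube d) (2 * p ^ d) := by
  classical
  have hp' : (0 : ℝ) < p := by positivity
  have hd' : (0 : ℝ) < d := by exact_mod_cast hd
  -- With side `2 / p` rather than `1 / p`, the faces `x i = 1` also fall into the `p ^ d` cells.
  -- Each cell wastes at most one point, so half of the `2 p ^ d` points still count.
  set h : ℝ := 2 / p
  have hh : 0 < h := by positivity
  set D := ENNReal.ofReal (h * d)
  have hD : D ^ (-s) ≠ ∞ := by
    have : D ≠ 0 := by simpa [D] using mul_pos hh hd'
    simp [this, D]
  refine le_iInf₂ fun ω hω => ?_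
  let I : Finset (Fin d → ℤ) := Fintype.piFinset fun _ => Finset.Ico 0 (p : ℤ)
  have hIc : I.card = p ^ d := by simp [I]
  have hI : ∀ x ∈ unitCube d, gridIndex h x ∈ I := by
    intro x hx
    refine Fintype.mem_piFinset.2 fun i => Finset.mem_Ico.2 ⟨?_, ?_⟩
    · exact Int.floor_nonneg.2 (div_nonneg (hx i).1 hh.le)
    · rw [gridIndex, Int.floor_lt, div_lt_iff₀ hh]
      have : ((p : ℤ) : ℝ) * h = 2 := by simp [h]; field_simp
      rw [this]
      linarith [(hx i).2]
  have h1 : D ^ (-s) * ω.card ≤ energy s ω + (p : ℝ≥0∞) ^ d * D ^ (-s) := by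
    calc D ^ (-s) * ω.card
        = ∑ k ∈ I, D ^ (-s) * ((ω.filter fun x => gridIndex h x = k).card : ℝ≥0∞) := by
          rw [card_eq_sum_card_gridIndex hI hω.2, ← Finset.mul_sum]
          push_cast; rfl
      _ ≤ ∑ k ∈ I, (energy s (ω.filter fun x => gridIndex h x = k) + D ^ (-s)) := by
          refine Finset.sum_le_sum fun k _ => rpow_mul_card_le_energy_add hs0 ?_
          intro x hx y hy
          rw [Finset.mem_filter] at hx hy
          rw [edist_dist]
          refine ENNReal.ofReal_le_ofReal (dist_le_of_mem_gridCube hh (k := k) ?_ ?_)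
          · rw [← hx.2]; exact mem_gridCube_gridIndex hh x
          · rw [← hy.2]; exact mem_gridCube_gridIndex hh y
      _ ≤ energy s ω + (p : ℝ≥0∞) ^ d * D ^ (-s) := by
          rw [Finset.sum_add_distrib, Finset.sum_const, hIc, nsmul_eq_mul]
          push_cast
          gcongr
          exact sum_energy_fiber_le s ω _ I
  rw [hω.1] at h1
  push_cast at h1
  rw [mul_comm ((p : ℝ≥0∞) ^ d), two_mul, mul_add] at h1
  exact (ENNReal.add_le_add_iff_right (ENNReal.mul_ne_top hD (by simp))).1 h1

theorem cubeConst_pos (hd : 1 ≤ d) {s : ℝ} (hs : (d : ℝ) < s) : 0 < cubeConst s d := by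
  have hd' : (0 : ℝ) < d := by exact_mod_cast hd
  have hs0 : 0 < s := hd'.trans hs
  have hsub : Tendsto (fun p : ℕ => 2 * p ^ d) atTop atTop :=
    Tendsto.const_mul_atTop' two_pos (tendsto_pow_atTop (by lia))
  have ht := (tendsto_minEnergy_unitCube hd hs).comp hsub
  set κ : ℝ≥0∞ := ENNReal.ofReal (2 * d) ^ (-s) / 2 ^ (1 + s / (d : ℝ))
  have hκ : 0 < κ := by
    refine ENNReal.div_pos ?_ ?_
    · rw [ENNReal.rpow_neg]
      exact ENNReal.inv_ne_zero.2 (ENNReal.rpow_ne_top_of_nonneg hs0.le ENNReal.ofReal_ne_top)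
    · exact ENNReal.rpow_ne_top_of_nonneg (by positivity) (by simp)
  refine lt_of_lt_of_le hκ (ge_of_tendsto ht ?_)
  filter_upwards [eventually_ge_atTop 2] with p hp
  have hp0 : (p : ℝ≥0∞) ≠ 0 := by norm_cast; lia
  have hp' : (0 : ℝ) < p := by positivity
  simp only [Function.comp_apply]
  have e1 : (((2 * p ^ d : ℕ) : ℝ≥0∞)) ^ (1 + s / (d : ℝ)) =
      2 ^ (1 + s / (d : ℝ)) * ((p : ℝ≥0∞) ^ d * (p : ℝ≥0∞) ^ s) := by
    push_cast
    rw [ENNReal.mul_rpow_of_nonneg _ _ (by positivity), ← ENNReal.rpow_natCast, ← ENNReal.rpow_mul,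
      ← ENNReal.rpow_add _ _ hp0 (by simp)]
    congr 2
    field_simp
  have e2 : ENNReal.ofReal (2 / p * d) ^ (-s) =
      ENNReal.ofReal (2 * d) ^ (-s) * (p : ℝ≥0∞) ^ s := by
    rw [div_mul_eq_mul_div, ENNReal.ofReal_div_of_pos hp', ENNReal.ofReal_natCast, div_eq_mul_inv,
      ENNReal.mul_rpow_of_ne_top ENNReal.ofReal_ne_top (by simp [hp0]), ENNReal.inv_rpow,
      ENNReal.rpow_neg (p : ℝ≥0∞), inv_inv]
  have h2p : ((2 * p ^ d : ℕ) : ℝ≥0∞) ≠ 0 := by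
    rw [Nat.cast_ne_zero]; positivity
  have hne0 := (ENNReal.rpow_pos (p := 1 + s / (d : ℝ)) (pos_iff_ne_zero.2 h2p)
    (ENNReal.natCast_ne_top _)).ne'
  rw [ENNReal.le_div_iff_mul_le (Or.inl hne0)
    (Or.inl (ENNReal.rpow_ne_top_of_nonneg (by positivity) (ENNReal.natCast_ne_top _))), e1,
    ← mul_assoc,
    ENNReal.div_mul_cancel (by simp) (ENNReal.rpow_ne_top_of_nonneg (by positivity) (by simp))]
  refine le_trans (le_of_eq ?_) (le_minEnergy_unitCube hd hs0 hp)
  rw [e2]; ring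

end Positivity

/-! ### Sharp lower bound for `s > d`. -/

section LowerBound

variable {d : ℕ}

/-- A lower bound for the energy of all configurations in a compact set, sharp to leading order. -/
lemma exists_rpow_card_le_energy_add (hd : 1 ≤ d) {s : ℝ} (hs : (d : ℝ) < s)
    {B : Set (EuclideanSpace ℝ (Fin d))} (hB : IsCompact B) {c : ℝ≥0∞} (hc : c ≠ ∞)
    (hcB : c * volume B ^ (s / (d : ℝ)) < cubeConst s d) :
    ∃ K : ℝ≥0∞, K ≠ ∞ ∧ ∀ ω : Finset (EuclideanSpace ℝ (Fin d)), (ω : Set _) ⊆ B →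
      c * (ω.card : ℝ≥0∞) ^ (1 + s / (d : ℝ)) ≤ energy s ω + K := by
  classical
  have hd' : (0 : ℝ) < d := by exact_mod_cast hd
  have hs0 : 0 < s := hd'.trans hs
  set t := s / (d : ℝ) with ht
  have ht0 : 0 < t := by positivity
  -- The slack in `hcB` leaves room for a grid cover of volume slightly above that of `B`.
  obtain ⟨v, hv, hv', hcv⟩ : ∃ v, volume B < v ∧ v ≠ ∞ ∧ c * v ^ t < cubeConst s d := by
    have h1 : Tendsto (fun v : ℝ≥0∞ => c * v ^ t) (𝓝 (volume B)) (𝓝 (c * volume B ^ t)) :=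
      ENNReal.Tendsto.const_mul ((ENNReal.continuous_rpow_const).tendsto _) (Or.inr hc)
    have h2 : ∀ᶠ v in 𝓝[>] (volume B), c * v ^ t < cubeConst s d :=
      (h1.mono_left nhdsWithin_le_nhds).eventually_lt_const hcB
    have : (𝓝[>] (volume B)).NeBot := nhdsGT_neBot_of_exists_gt ⟨∞, hB.measure_lt_top⟩
    have h3 : ∀ᶠ v in 𝓝[>] (volume B), v < ∞ :=
      nhdsWithin_le_nhds (eventually_lt_nhds hB.measure_lt_top)
    obtain ⟨v, h2, h3, h4⟩ := (h2.and (h3.and self_mem_nhdsWithin)).exists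
    exact ⟨v, h4, h3.ne, h2⟩
  set c' := c * v ^ t with hc'
  -- `K₀` absorbs the small `n`, for which the limit says nothing.
  obtain ⟨K₀, hK₀, hgK⟩ : ∃ K₀ : ℝ≥0∞, K₀ ≠ ∞ ∧ ∀ n : ℕ,
      c' * (n : ℝ≥0∞) ^ (1 + t) ≤ minEnergy s (unitCube d) n + K₀ := by
    have h1 := (tendsto_minEnergy_unitCube hd hs).eventually_const_lt hcv
    obtain ⟨n₀, hn₀⟩ := eventually_atTop.1 h1
    refine ⟨c' * (n₀ : ℝ≥0∞) ^ (1 + t), ?_, fun n => ?_⟩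
    · refine ENNReal.mul_ne_top ?_ (ENNReal.rpow_ne_top_of_nonneg (by positivity) (by simp))
      exact ENNReal.mul_ne_top hc (ENNReal.rpow_ne_top_of_nonneg ht0.le hv')
    · rcases le_total n₀ n with h | h
      · refine le_trans ?_ le_self_add
        exact ENNReal.mul_le_of_le_div (hn₀ n h).le
      · refine le_trans ?_ le_add_self
        gcongr
  obtain ⟨h, hh, I, hI, hIv⟩ := exists_grid_cover hB hv hv'
  have hh0 : ENNReal.ofReal h ≠ 0 := by simpa using hh
  have hhs : ENNReal.ofReal h ^ (-s) ≠ ∞ := by simp [hh0]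
  refine ⟨(I.card : ℝ≥0∞) * (ENNReal.ofReal h ^ (-s) * K₀),
    ENNReal.mul_ne_top (by simp) (ENNReal.mul_ne_top hhs hK₀), fun ω hω => ?_⟩
  let n : (Fin d → ℤ) → ℕ := fun k => (ω.filter fun x => gridIndex h x = k).card
  have hM : (I.card : ℝ≥0∞) ^ t ≤ v ^ t * ENNReal.ofReal h ^ (-s) := by
    have h1 := ENNReal.rpow_le_rpow hIv ht0.le
    rw [ENNReal.mul_rpow_of_nonneg _ _ ht0.le, ← ENNReal.rpow_natCast, ← ENNReal.rpow_mul, ht,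
      mul_div_cancel₀ _ hd'.ne', ← ht] at h1
    rwa [ENNReal.rpow_neg, ← div_eq_mul_inv,
      ENNReal.le_div_iff_mul_le (Or.inl (by simp [hh0])) (Or.inl (by simp [hh0]))]
  calc c * (ω.card : ℝ≥0∞) ^ (1 + t)
      = c * (∑ k ∈ I, (n k : ℝ≥0∞)) ^ (1 + t) := by
        rw [card_eq_sum_card_gridIndex hI hω]; push_cast; rfl
    _ ≤ c * ((I.card : ℝ≥0∞) ^ t * ∑ k ∈ I, (n k : ℝ≥0∞) ^ (1 + t)) := by
        gcongr
        -- Power mean inequality: equal occupation of the cells is the worst case.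
        have := ENNReal.rpow_sum_le_const_mul_sum_rpow I (fun k => (n k : ℝ≥0∞))
          (p := 1 + t) (by linarith)
        rwa [add_sub_cancel_left] at this
    _ ≤ c * ((v ^ t * ENNReal.ofReal h ^ (-s)) * ∑ k ∈ I, (n k : ℝ≥0∞) ^ (1 + t)) := by
        gcongr
    _ = ∑ k ∈ I, ENNReal.ofReal h ^ (-s) * (c' * (n k : ℝ≥0∞) ^ (1 + t)) := by
        rw [hc', ← Finset.mul_sum, ← Finset.mul_sum]; ring
    _ ≤ ∑ k ∈ I, ENNReal.ofReal h ^ (-s) * (minEnergy s (unitCube d) (n k) + K₀) := by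
        gcongr with k
        exact hgK (n k)
    _ ≤ ∑ k ∈ I, (energy s (ω.filter fun x => gridIndex h x = k) +
          ENNReal.ofReal h ^ (-s) * K₀) := by
        refine Finset.sum_le_sum fun k _ => ?_
        rw [mul_add]
        gcongr
        refine minEnergy_unitCube_le_of_subset_gridCube s hh k fun x hx => ?_
        rw [← (Finset.mem_filter.1 (Finset.mem_coe.1 hx)).2]
        exact mem_gridCube_gridIndex hh x
    _ ≤ _ := by
        rw [Finset.sum_add_distrib, Finset.sum_const, nsmul_eq_mul]
        gcongr
        exact sum_energy_fiber_le s ω _ I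

end LowerBound

/-! ### The kernel `|x|^(-d)` as a mixture of ball overlaps. -/

section Overlap

variable {d : ℕ}

/-- The volume of the intersection of two unit balls whose centers differ by `v`. -/
noncomputable def overlap (v : EuclideanSpace ℝ (Fin d)) : ℝ≥0∞ :=
  volume (Metric.ball 0 1 ∩ Metric.ball v 1)

/-- The volume of the unit ball. -/
noncomputable def ballVol (d : ℕ) : ℝ≥0∞ := volume (Metric.ball (0 : EuclideanSpace ℝ (Fin d)) 1)

lemma ballVol_ne_top : ballVol d ≠ ∞ := measure_ball_lt_top.ne

lemma ballVol_ne_zero : ballVol d ≠ 0 := (Metric.measure_ball_pos _ _ one_pos).ne'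

lemma overlap_zero : overlap (0 : EuclideanSpace ℝ (Fin d)) = ballVol d := by
  rw [overlap, Set.inter_self, ballVol]

/-- The reflection exchanging `v` and `w` preserves volume and the unit ball at the origin. -/
lemma overlap_eq_of_norm_eq {v w : EuclideanSpace ℝ (Fin d)} (h : ‖v‖ = ‖w‖) :
    overlap v = overlap w := by
  set R : EuclideanSpace ℝ (Fin d) ≃ₗᵢ[ℝ] EuclideanSpace ℝ (Fin d) :=
    Submodule.reflection (ℝ ∙ (v - w))ᗮ
  have hR : R v = w := Submodule.reflection_sub h
  have hpre : R ⁻¹' (Metric.ball 0 1 ∩ Metric.ball w 1) = Metric.ball 0 1 ∩ Metric.ball v 1 := by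
    ext z
    simp only [Set.mem_preimage, Set.mem_inter_iff, Metric.mem_ball, ← hR, R.dist_map,
      dist_zero_right, R.norm_map]
  rw [overlap, overlap, ← hpre, R.measurePreserving.measure_preimage
    (measurableSet_ball.inter measurableSet_ball).nullMeasurableSet]

lemma volume_ball_inter_ball (x y : EuclideanSpace ℝ (Fin d)) :
    volume (Metric.ball x 1 ∩ Metric.ball y 1) = overlap (y - x) := by
  have : Metric.ball x 1 ∩ Metric.ball y 1 =
      (fun z => z - x) ⁻¹' (Metric.ball 0 1 ∩ Metric.ball (y - x) 1) := by
    ext z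
    simp [dist_eq_norm]
  rw [this, (measurePreserving_sub_right volume x).measure_preimage
    (measurableSet_ball.inter measurableSet_ball).nullMeasurableSet, overlap]

/-- The indicator function of the unit ball. -/
noncomputable def ballInd (d : ℕ) : EuclideanSpace ℝ (Fin d) → ℝ≥0∞ :=
  (Metric.ball 0 1).indicator 1

lemma measurable_ballInd : Measurable (ballInd d) :=
  measurable_one.indicator measurableSet_ball

lemma lintegral_ballInd : ∫⁻ z, ballInd d z = ballVol d :=
  lintegral_indicator_one measurableSet_ball

/-- `overlap` is the convolution of the ball's indicator with itself, hence has total integral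
`ballVol d ^ 2`. -/
lemma overlap_eq_lintegral (v : EuclideanSpace ℝ (Fin d)) :
    overlap v = ∫⁻ z, ballInd d z * ballInd d (v - z) := by
  rw [overlap, ← lintegral_indicator_one (measurableSet_ball.inter measurableSet_ball)]
  refine lintegral_congr fun z => ?_
  have h : (Metric.ball v 1).indicator (1 : EuclideanSpace ℝ (Fin d) → ℝ≥0∞) z =
      ballInd d (v - z) := by
    have hiff : z ∈ Metric.ball v 1 ↔ v - z ∈ Metric.ball (0 : EuclideanSpace ℝ (Fin d)) 1 := by
      rw [mem_ball_zero_iff, Metric.mem_ball, dist_comm, dist_eq_norm]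
    rw [ballInd]
    by_cases hz : z ∈ Metric.ball v 1
    · rw [Set.indicator_of_mem hz, Set.indicator_of_mem (hiff.1 hz)]; rfl
    · rw [Set.indicator_of_notMem hz, Set.indicator_of_notMem (fun h => hz (hiff.2 h))]
  rw [Set.inter_indicator_one, Pi.mul_apply, h, ballInd]

lemma measurable_overlap_integrand : Measurable
    fun p : EuclideanSpace ℝ (Fin d) × EuclideanSpace ℝ (Fin d) =>
      ballInd d p.2 * ballInd d (p.1 - p.2) :=
  (measurable_ballInd.comp measurable_snd).mul
    (measurable_ballInd.comp (measurable_fst.sub measurable_snd))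

lemma measurable_overlap : Measurable (overlap (d := d)) := by
  have := (measurable_overlap_integrand (d := d)).lintegral_prod_right' (ν := volume)
  exact (funext overlap_eq_lintegral : overlap (d := d) = _) ▸ this

lemma lintegral_overlap : ∫⁻ v, overlap (d := d) v = ballVol d ^ 2 := by
  simp_rw [overlap_eq_lintegral]
  rw [lintegral_lintegral_swap measurable_overlap_integrand.aemeasurable]
  have h1 : ∀ z : EuclideanSpace ℝ (Fin d),
      ∫⁻ v, ballInd d z * ballInd d (v - z) = ballInd d z * ballVol d := by
    intro z
    have hz : Measurable fun v => ballInd d (v - z) :=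
      measurable_ballInd.comp (measurable_id.sub_const z)
    rw [lintegral_const_mul _ hz, lintegral_sub_right_eq_self (ballInd d) z, lintegral_ballInd]
  simp_rw [h1]
  rw [lintegral_mul_const _ measurable_ballInd, lintegral_ballInd, sq]

/-- The kernel `|x| ^ (-d)` is a mixture of the positive definite kernels `x ↦ overlap (r • x)`. -/
lemma lintegral_overlap_norm_smul {x : EuclideanSpace ℝ (Fin d)} (hx : x ≠ 0) :
    ∫⁻ w : EuclideanSpace ℝ (Fin d), overlap (‖w‖ • x) =
      ballVol d ^ 2 * ENNReal.ofReal ((‖x‖ ^ d)⁻¹) := by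
  have hx' : ‖x‖ ≠ 0 := norm_ne_zero_iff.2 hx
  -- Radial symmetry swaps the roles of `w` and `x`; the dilation `w ↦ ‖x‖ • w` then produces the
  -- Jacobian `‖x‖^(-d)`.
  have h1 : ∀ w : EuclideanSpace ℝ (Fin d), overlap (‖w‖ • x) = overlap (‖x‖ • w) := fun w =>
    overlap_eq_of_norm_eq (by simp [norm_smul, mul_comm])
  simp_rw [h1]
  rw [← lintegral_map (μ := volume) (f := overlap) (g := fun w => ‖x‖ • w) measurable_overlap
    (measurable_const_smul _), Measure.map_addHaar_smul _ hx', lintegral_smul_measure,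
    lintegral_overlap, finrank_euclideanSpace_fin, smul_eq_mul, mul_comm,
    abs_of_nonneg (by positivity)]

end Overlap

/-! ### Lower bound for overlap sums at one scale. -/

section CauchySchwarz

variable {d : ℕ}

lemma sq_lintegral_le_mul_measure {α : Type*} [MeasurableSpace α] {μ : Measure α}
    {f : α → ℝ≥0∞} (hf : Measurable f) {S : Set α} (hS : MeasurableSet S)
    (hfS : ∀ x, x ∉ S → f x = 0) :
    (∫⁻ x, f x ∂μ) ^ 2 ≤ (∫⁻ x, f x ^ 2 ∂μ) * μ S := by
  have h1 : ∀ x, f x = (f * S.indicator (1 : α → ℝ≥0∞)) x := fun x => by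
    by_cases hx : x ∈ S
    · simp [hx]
    · simp [hx, hfS x hx]
  have h2 := ENNReal.lintegral_mul_le_Lp_mul_Lq μ Real.HolderConjugate.two_two
    hf.aemeasurable ((measurable_one (α := ℝ≥0∞) (β := α)).indicator hS).aemeasurable
  simp_rw [← h1] at h2
  have h3 : ∀ x, S.indicator (1 : α → ℝ≥0∞) x ^ (2 : ℝ) = S.indicator 1 x := fun x => by
    by_cases hx : x ∈ S <;> simp [hx]
  simp_rw [h3] at h2
  rw [lintegral_indicator_one hS] at h2
  calc (∫⁻ x, f x ∂μ) ^ 2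
      ≤ ((∫⁻ x, f x ^ (2 : ℝ) ∂μ) ^ (1 / (2 : ℝ)) * μ S ^ (1 / (2 : ℝ))) ^ 2 := by gcongr
    _ = (∫⁻ x, f x ^ 2 ∂μ) * μ S := by
      rw [mul_pow, ← ENNReal.rpow_natCast, ← ENNReal.rpow_natCast, ← ENNReal.rpow_mul,
        ← ENNReal.rpow_mul]
      norm_num

/-- Let `n` count the unit balls around the points `a • x` that cover a given point. Then `∫ n` and
`∫ n²` are the point count times `ballVol d` and the overlap sum, and `n` lives on the `a`-dilate of
the `R`-thickening because `1 / a ≤ R`. Cauchy–Schwarz does the rest. -/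
lemma sq_card_mul_ballVol_le {B : Set (EuclideanSpace ℝ (Fin d))} {a R : ℝ} (ha : 0 < a)
    (haR : 1 / a ≤ R) {ω : Finset (EuclideanSpace ℝ (Fin d))} (hω : (ω : Set _) ⊆ B) :
    ((ω.card : ℝ≥0∞) * ballVol d) ^ 2 ≤
      (∑ x ∈ ω, ∑ y ∈ ω, overlap (a • (y - x))) *
        (ENNReal.ofReal (a ^ d) * volume (Metric.cthickening R B)) := by
  set n : EuclideanSpace ℝ (Fin d) → ℝ≥0∞ :=
    fun z => ∑ x ∈ ω, (Metric.ball (a • x) 1).indicator 1 z with hn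
  have hmeas : ∀ x : EuclideanSpace ℝ (Fin d),
      Measurable ((Metric.ball x 1).indicator (1 : EuclideanSpace ℝ (Fin d) → ℝ≥0∞)) :=
    fun x => measurable_one.indicator measurableSet_ball
  have hnm : Measurable n := Finset.measurable_sum _ fun x _ => hmeas _
  set S : Set (EuclideanSpace ℝ (Fin d)) := (fun z => a⁻¹ • z) ⁻¹' Metric.cthickening R B with hS
  have hSm : MeasurableSet S :=
    Metric.isClosed_cthickening.measurableSet.preimage (measurable_const_smul _)
  have hSv : volume S = ENNReal.ofReal (a ^ d) * volume (Metric.cthickening R B) := by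
    rw [hS, Measure.addHaar_preimage_smul _ (inv_ne_zero ha.ne'), finrank_euclideanSpace_fin,
      inv_pow, inv_inv, abs_of_pos (by positivity)]
  have hnS : ∀ z, z ∉ S → n z = 0 := by
    intro z hz
    refine Finset.sum_eq_zero fun x hx => Set.indicator_of_notMem (fun hzx => hz ?_) _
    suffices h : dist (a⁻¹ • z) x < R from
      Metric.thickening_subset_cthickening R B (Metric.mem_thickening_iff.2 ⟨x, hω hx, h⟩)
    refine lt_of_lt_of_le ?_ haR
    have h1 : a⁻¹ • z - x = a⁻¹ • (z - a • x) := by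
      rw [smul_sub, inv_smul_smul₀ ha.ne']
    rw [dist_eq_norm, h1, norm_smul, Real.norm_of_nonneg (by positivity), one_div]
    rw [Metric.mem_ball, dist_eq_norm] at hzx
    nlinarith [inv_pos.2 ha]
  have hint : ∫⁻ z, n z = ω.card * ballVol d := by
    rw [hn, lintegral_finsetSum _ fun x _ => hmeas _]
    simp only [lintegral_indicator_one measurableSet_ball, Measure.addHaar_ball_center, ballVol]
    simp
  have hint2 : ∫⁻ z, n z ^ 2 = ∑ x ∈ ω, ∑ y ∈ ω, overlap (a • (y - x)) := by
    have : ∀ z, n z ^ 2 = ∑ x ∈ ω, ∑ y ∈ ω,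
        (Metric.ball (a • x) 1 ∩ Metric.ball (a • y) 1).indicator 1 z := fun z => by
      rw [hn, sq, Finset.sum_mul_sum]
      simp only [Set.inter_indicator_one, Pi.mul_apply]
    simp_rw [this]
    rw [lintegral_finsetSum _ fun x _ => Finset.measurable_sum _ fun y _ =>
      measurable_one.indicator (measurableSet_ball.inter measurableSet_ball)]
    refine Finset.sum_congr rfl fun x _ => ?_
    rw [lintegral_finsetSum _ fun y _ =>
      measurable_one.indicator (measurableSet_ball.inter measurableSet_ball)]
    refine Finset.sum_congr rfl fun y _ => ?_
    rw [lintegral_indicator_one (measurableSet_ball.inter measurableSet_ball),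
      volume_ball_inter_ball, smul_sub]
  have := sq_lintegral_le_mul_measure (μ := volume) hnm hSm hnS
  rwa [hint, hint2, hSv] at this

end CauchySchwarz

/-! ### Sharp lower bound for `s = d`. -/

section CriticalExponent

variable {d : ℕ}

/-- The spherical shell `a < ‖w‖ ≤ b`. -/
def shell (d : ℕ) (a b : ℝ) : Set (EuclideanSpace ℝ (Fin d)) := {w | ‖w‖ ∈ Set.Ioc a b}

lemma measurableSet_shell (a b : ℝ) : MeasurableSet (shell d a b) :=
  measurableSet_Ioc.preimage measurable_norm

lemma volume_shell_le {b : ℝ} (a : ℝ) (hb : 0 ≤ b) :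
    volume (shell d a b) ≤ ENNReal.ofReal (b ^ d) * ballVol d := by
  calc volume (shell d a b) ≤ volume (Metric.closedBall (0 : EuclideanSpace ℝ (Fin d)) b) :=
        measure_mono fun w hw => mem_closedBall_zero_iff.2 hw.2
    _ = ENNReal.ofReal (b ^ d) * ballVol d := by
        rw [Measure.addHaar_closedBall _ _ hb, finrank_euclideanSpace_fin, ballVol]

/-- In polar coordinates the radial density is `y^(d-1) * y^(-d) = 1/y`: the source of the
logarithm. -/
lemma lintegral_shell_inv_norm_pow (hd : 1 ≤ d) {a b : ℝ} (ha : 0 < a) (hab : a ≤ b) :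
    ∫⁻ w in shell d a b, ENNReal.ofReal ((‖w‖ ^ d)⁻¹) =
      ENNReal.ofReal (d * Real.log (b / a)) * ballVol d := by
  have : Nonempty (Fin d) := ⟨⟨0, hd⟩⟩
  set f : ℝ → ℝ := (Set.Ioc a b).indicator fun y => (y ^ d)⁻¹ with hf
  have h1 : Set.EqOn (fun y : ℝ => y ^ (d - 1) • f y) ((Set.Ioc a b).indicator fun y => y⁻¹)
      (Set.Ioi 0) := by
    intro y hy
    have hy' : y ≠ 0 := ne_of_gt hy
    by_cases hyab : y ∈ Set.Ioc a b
    · simp only [hf, Set.indicator_of_mem hyab, smul_eq_mul]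
      rw [← div_eq_mul_inv, div_eq_iff (pow_ne_zero _ hy'), eq_comm, inv_mul_eq_iff_eq_mul₀ hy',
        ← pow_succ', Nat.sub_add_cancel hd]
    · simp [hf, Set.indicator_of_notMem hyab]
  have hint : IntegrableOn (fun y : ℝ => y⁻¹) (Set.Ioc a b) := by
    rw [← intervalIntegrable_iff_integrableOn_Ioc_of_le hab]
    refine intervalIntegral.intervalIntegrable_inv (fun x hx => ?_) continuousOn_id
    rw [Set.uIcc_of_le hab] at hx
    exact (ha.trans_le hx.1).ne'
  have hsub : Set.Ioc a b ⊆ Set.Ioi 0 := fun y hy => ha.trans hy.1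
  have hI : Integrable (fun w : EuclideanSpace ℝ (Fin d) => f ‖w‖) := by
    rw [integrable_fun_norm_addHaar volume, finrank_euclideanSpace_fin,
      integrableOn_congr_fun h1 measurableSet_Ioi]
    exact ((integrable_indicator_iff measurableSet_Ioc).2 hint).integrableOn
  have hval : ∫ w : EuclideanSpace ℝ (Fin d), f ‖w‖ =
      d * Real.log (b / a) * (ballVol d).toReal := by
    rw [integral_fun_norm_addHaar volume f, finrank_euclideanSpace_fin,
      setIntegral_congr_fun measurableSet_Ioi h1, setIntegral_indicator measurableSet_Ioc,
      Set.inter_eq_right.2 hsub, ← intervalIntegral.integral_of_le hab,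
      integral_inv_of_pos ha (ha.trans_le hab)]
    simp only [nsmul_eq_mul, smul_eq_mul, Measure.real, ballVol]
    ring
  have hnn : ∀ w : EuclideanSpace ℝ (Fin d), 0 ≤ f ‖w‖ := fun w =>
    Set.indicator_nonneg (fun y hy => by have := ha.trans hy.1; positivity) _
  have hlog : 0 ≤ Real.log (b / a) := Real.log_nonneg ((one_le_div ha).2 hab)
  rw [← lintegral_indicator (measurableSet_shell a b)]
  calc ∫⁻ w, (shell d a b).indicator (fun w => ENNReal.ofReal ((‖w‖ ^ d)⁻¹)) w
      = ∫⁻ w : EuclideanSpace ℝ (Fin d), ENNReal.ofReal (f ‖w‖) := by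
        refine lintegral_congr fun w => ?_
        by_cases hw : w ∈ shell d a b
        · rw [Set.indicator_of_mem hw, hf, Set.indicator_of_mem (show ‖w‖ ∈ Set.Ioc a b from hw)]
        · rw [Set.indicator_of_notMem hw, hf,
            Set.indicator_of_notMem (show ‖w‖ ∉ Set.Ioc a b from hw), ENNReal.ofReal_zero]
    _ = ENNReal.ofReal (d * Real.log (b / a)) * ballVol d := by
        rw [← ofReal_integral_eq_lintegral_ofReal hI (Eventually.of_forall hnn), hval,
          ENNReal.ofReal_mul (by positivity), ENNReal.ofReal_toReal ballVol_ne_top]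

lemma lintegral_shell_overlap_le (a b : ℝ) {x y : EuclideanSpace ℝ (Fin d)} (hxy : x ≠ y) :
    ∫⁻ w in shell d a b, overlap (‖w‖ • (y - x)) ≤
      ballVol d ^ 2 * (1 / edist y x ^ (d : ℝ)) := by
  refine (setLIntegral_le_lintegral _ _).trans (le_of_eq ?_)
  have h : 0 < ‖y - x‖ := norm_pos_iff.2 (sub_ne_zero.2 hxy.symm)
  rw [lintegral_overlap_norm_smul (sub_ne_zero.2 hxy.symm), edist_dist, dist_eq_norm,
    ENNReal.rpow_natCast, one_div, ENNReal.ofReal_inv_of_pos (by positivity),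
    ENNReal.ofReal_pow h.le]

/-- The outer radius `b` is needed for the diagonal `x = y`, where the overlap is constant in `w`
and its integral over the whole space diverges. -/
lemma lintegral_shell_sum_overlap_le (a : ℝ) {b : ℝ} (hb : 0 ≤ b)
    (ω : Finset (EuclideanSpace ℝ (Fin d))) :
    ∫⁻ w in shell d a b, ∑ x ∈ ω, ∑ y ∈ ω, overlap (‖w‖ • (y - x)) ≤
      ballVol d ^ 2 * (energy d ω + ω.card * ENNReal.ofReal (b ^ d)) := by
  classical
  have hm : ∀ v : EuclideanSpace ℝ (Fin d),
      Measurable fun w : EuclideanSpace ℝ (Fin d) => overlap (‖w‖ • v) := fun v =>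
    measurable_overlap.comp (measurable_norm.smul_const v)
  rw [lintegral_finsetSum _ fun x _ => Finset.measurable_sum _ fun y _ => hm _]
  have hx : ∀ x ∈ ω, ∫⁻ w in shell d a b, ∑ y ∈ ω, overlap (‖w‖ • (y - x)) ≤
      ballVol d ^ 2 * (∑ y ∈ ω.erase x, 1 / edist y x ^ (d : ℝ)) +
        ballVol d ^ 2 * ENNReal.ofReal (b ^ d) := by
    intro x hx
    rw [lintegral_finsetSum _ fun y _ => hm _, ← Finset.sum_erase_add _ _ hx, Finset.mul_sum]
    refine add_le_add (Finset.sum_le_sum fun y hy => ?_) ?_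
    · exact lintegral_shell_overlap_le a b (Finset.ne_of_mem_erase hy).symm
    · simp only [sub_self, smul_zero, overlap_zero, lintegral_const,
        Measure.restrict_apply MeasurableSet.univ, Set.univ_inter]
      calc ballVol d * volume (shell d a b)
          ≤ ballVol d * (ENNReal.ofReal (b ^ d) * ballVol d) := by
            gcongr; exact volume_shell_le a hb
        _ = _ := by ring
  refine (Finset.sum_le_sum hx).trans (le_of_eq ?_)
  rw [Finset.sum_add_distrib, ← Finset.mul_sum, Finset.sum_const, nsmul_eq_mul, energy]
  ring

/-- The single-scale bound is integrated over the shell; the inner radius `R⁻¹` is where the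
rescaled balls start to fit in the `R`-thickening. -/
lemma sq_card_mul_log_le_energy_add (hd : 1 ≤ d) {B : Set (EuclideanSpace ℝ (Fin d))} {R b : ℝ}
    (hR : 0 < R) (hb : R⁻¹ ≤ b) (hV0 : volume (Metric.cthickening R B) ≠ 0)
    (hVt : volume (Metric.cthickening R B) ≠ ∞)
    {ω : Finset (EuclideanSpace ℝ (Fin d))} (hω : (ω : Set _) ⊆ B) :
    (ω.card : ℝ≥0∞) ^ 2 * (ENNReal.ofReal (d * Real.log (b * R)) * ballVol d) /
      volume (Metric.cthickening R B) ≤ energy d ω + ω.card * ENNReal.ofReal (b ^ d) := by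
  set V := volume (Metric.cthickening R B)
  have hR' : 0 < R⁻¹ := inv_pos.2 hR
  have h1 := lintegral_shell_sum_overlap_le R⁻¹ (hR'.le.trans hb) ω
  have h2 : ∫⁻ w in shell d R⁻¹ b,
      ((ω.card : ℝ≥0∞) * ballVol d) ^ 2 / V * ENNReal.ofReal ((‖w‖ ^ d)⁻¹) ≤
      ∫⁻ w in shell d R⁻¹ b, ∑ x ∈ ω, ∑ y ∈ ω, overlap (‖w‖ • (y - x)) := by
    refine setLIntegral_mono' (measurableSet_shell _ _) fun w hw => ?_
    have hw0 : 0 < ‖w‖ := hR'.trans hw.1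
    have h3 := sq_card_mul_ballVol_le hw0 (R := R)
      (by rw [one_div]; exact inv_le_of_inv_le₀ hR hw.1.le) hω
    have hpos : 0 < ‖w‖ ^ d := by positivity
    rw [ENNReal.ofReal_inv_of_pos hpos, div_eq_mul_inv, mul_assoc,
      ← ENNReal.mul_inv (Or.inl hV0) (Or.inl hVt), ← div_eq_mul_inv,
      mul_comm V]
    exact ENNReal.div_le_of_le_mul h3
  have h3 := h2.trans h1
  rw [lintegral_const_mul _ (by fun_prop), lintegral_shell_inv_norm_pow hd hR' hb,
    div_inv_eq_mul] at h3
  have hβ0 : ballVol d ^ 2 ≠ 0 := pow_ne_zero _ ballVol_ne_zero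
  have hβt : ballVol d ^ 2 ≠ ∞ := ENNReal.pow_ne_top ballVol_ne_top
  refine (ENNReal.mul_le_mul_iff_right hβ0 hβt).1 (le_trans (le_of_eq ?_) h3)
  simp only [div_eq_mul_inv]
  ring

/-- A lower bound for the energy with critical exponent of all configurations in a compact set,
sharp to leading order. -/
lemma exists_sq_card_mul_log_le_energy_add (hd : 1 ≤ d)
    {B : Set (EuclideanSpace ℝ (Fin d))} (hB : IsCompact B) {c : ℝ≥0∞} (hc : c ≠ ∞)
    (hcB : c * volume B < ballVol d) :
    ∃ K : ℝ≥0∞, K ≠ ∞ ∧ ∀ ω : Finset (EuclideanSpace ℝ (Fin d)), (ω : Set _) ⊆ B →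
      c * ENNReal.ofReal ((ω.card : ℝ) ^ 2 * Real.log ω.card) ≤ energy d ω + K := by
  have hd' : (0 : ℝ) < d := by exact_mod_cast hd
  rcases B.eq_empty_or_nonempty with rfl | hBne
  · refine ⟨0, by simp, fun ω hω => ?_⟩
    have : ω = ∅ := by simpa using hω
    simp [this]
  obtain ⟨R, hR, hcR⟩ : ∃ R : ℝ, 0 < R ∧ c * volume (Metric.cthickening R B) < ballVol d := by
    have h1 : Tendsto (fun r => c * volume (Metric.cthickening r B)) (𝓝[>] 0)
        (𝓝 (c * volume B)) :=
      (ENNReal.Tendsto.const_mul (tendsto_measure_cthickening_of_isCompact hB)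
        (Or.inr hc)).mono_left nhdsWithin_le_nhds
    obtain ⟨R, h2, h3⟩ := ((h1.eventually_lt_const hcB).and self_mem_nhdsWithin).exists
    exact ⟨R, h3, h2⟩
  set V := volume (Metric.cthickening R B) with hV
  have hVt : V ≠ ∞ := hB.cthickening.measure_lt_top.ne
  have hV0 : V ≠ 0 := by
    obtain ⟨x, hx⟩ := hBne
    refine ne_of_gt ((Metric.measure_ball_pos volume x hR).trans_le (measure_mono ?_))
    exact (Metric.ball_subset_thickening hx R).trans (Metric.thickening_subset_cthickening R B)
  set β := (ballVol d).toReal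
  set v := V.toReal
  set c' := c.toReal
  have hv : 0 < v := ENNReal.toReal_pos hV0 hVt
  have hβ : 0 < β := ENNReal.toReal_pos ballVol_ne_zero ballVol_ne_top
  have hcβ : c' * v < β := by
    rw [← ENNReal.toReal_mul]
    exact (ENNReal.toReal_lt_toReal (ENNReal.mul_ne_top hc hVt) ballVol_ne_top).2 hcR
  have hlim : Tendsto (fun n : ℕ => (β / v - c') * Real.log n) atTop atTop :=
    Tendsto.const_mul_atTop (sub_pos.2 ((lt_div_iff₀ hv).2 hcβ))
      (Real.tendsto_log_atTop.comp tendsto_natCast_atTop_atTop)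
  have hlim2 : Tendsto (fun n : ℕ => (n : ℝ) ^ (1 / (d : ℝ))) atTop atTop :=
    (tendsto_rpow_atTop (by positivity)).comp tendsto_natCast_atTop_atTop
  -- Beyond `n₀` the gap `β / v - c'` times `log n` beats the bounded terms: the shift by `log R`
  -- and the diagonal. With `b = n^(1/d)`, the diagonal costs only `n²` while `d log b = log n`.
  obtain ⟨n₀, hn₀⟩ := eventually_atTop.1 ((hlim.eventually_ge_atTop
    (1 - β * (d * Real.log R) / v)).and ((hlim2.eventually_ge_atTop R⁻¹).and
      (eventually_ge_atTop 1)))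
  refine ⟨c * ENNReal.ofReal ((n₀ : ℝ) ^ 2 * Real.log n₀),
    ENNReal.mul_ne_top hc ENNReal.ofReal_ne_top, fun ω hω => ?_⟩
  rcases le_total ω.card n₀ with hle | hle
  · refine le_trans ?_ le_add_self
    rcases Nat.eq_zero_or_pos ω.card with h0 | hpos
    · simp [h0]
    · have : (ω.card : ℝ) ≤ n₀ := by exact_mod_cast hle
      have h1 : (1 : ℝ) ≤ ω.card := by exact_mod_cast hpos
      have := Real.log_nonneg h1
      gcongr
  · refine le_trans ?_ le_self_add
    obtain ⟨h1, h2, h3⟩ := hn₀ _ hle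
    set n := ω.card
    have hn : (0 : ℝ) < n := by exact_mod_cast h3
    have h4 := sq_card_mul_log_le_energy_add hd hR h2 hV0 hVt hω
    have hbd : ((n : ℝ) ^ (1 / (d : ℝ))) ^ d = n := by
      rw [← Real.rpow_natCast, ← Real.rpow_mul hn.le, one_div_mul_cancel hd'.ne', Real.rpow_one]
    have hlogb : d * Real.log ((n : ℝ) ^ (1 / (d : ℝ)) * R) = Real.log n + d * Real.log R := by
      rw [Real.log_mul (by positivity) hR.ne', Real.log_rpow hn]
      field_simp
    rw [hbd, hlogb] at h4
    have hlog0 : 0 ≤ Real.log n + d * Real.log R := by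
      rw [← hlogb]
      refine mul_nonneg hd'.le (Real.log_nonneg ?_)
      rw [inv_le_iff_one_le_mul₀ hR] at h2
      exact h2
    have e1 : (n : ℝ≥0∞) ^ 2 * (ENNReal.ofReal (Real.log n + d * Real.log R) * ballVol d) / V =
        ENNReal.ofReal ((n : ℝ) ^ 2 * ((Real.log n + d * Real.log R) * β) / v) := by
      rw [ENNReal.ofReal_div_of_pos hv, ENNReal.ofReal_mul (by positivity),
        ENNReal.ofReal_mul hlog0, ENNReal.ofReal_toReal ballVol_ne_top, ENNReal.ofReal_toReal hVt,
        ENNReal.ofReal_pow hn.le, ENNReal.ofReal_natCast]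
    have e2 : (n : ℝ≥0∞) * ENNReal.ofReal n = ENNReal.ofReal ((n : ℝ) ^ 2) := by
      rw [ENNReal.ofReal_pow hn.le, ENNReal.ofReal_natCast, sq]
    have hlogn : 0 ≤ Real.log n := Real.log_nonneg (by exact_mod_cast h3)
    rw [e1, e2] at h4
    refine (ENNReal.add_le_add_iff_right (a := ENNReal.ofReal ((n : ℝ) ^ 2))
      ENNReal.ofReal_ne_top).1 (le_trans ?_ h4)
    rw [← ENNReal.ofReal_toReal hc, ← ENNReal.ofReal_mul ENNReal.toReal_nonneg,
      ← ENNReal.ofReal_add (by positivity) (by positivity)]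
    refine ENNReal.ofReal_le_ofReal ?_
    have e3 : (n : ℝ) ^ 2 * ((Real.log n + d * Real.log R) * β) / v -
        (c' * ((n : ℝ) ^ 2 * Real.log n) + (n : ℝ) ^ 2) =
        (n : ℝ) ^ 2 * ((β / v - c') * Real.log n - (1 - β * (d * Real.log R) / v)) := by
      field_simp
      ring
    have : 0 ≤ (n : ℝ) ^ 2 * ((β / v - c') * Real.log n - (1 - β * (d * Real.log R) / v)) :=
      mul_nonneg (by positivity) (sub_nonneg.2 h1)
    linarith

end CriticalExponent

/-! ### Uniqueness of the optimal split of mass. -/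

section Convexity

/-- A convexity argument: two masses `p` and `1 - p` minimize the limiting energy only when they
are proportional to the volumes. -/
lemma eq_div_of_forall_add_le {v₁ v₂ p t C : ℝ} (hv₁ : 0 ≤ v₁) (hv₂ : 0 ≤ v₂) (hV : 0 < v₁ + v₂)
    (hp0 : 0 ≤ p) (hp1 : p ≤ 1) (ht : 0 < t) (hC : 0 < C)
    (H : ∀ c₁ c₂ : ℝ, 0 ≤ c₁ → 0 ≤ c₂ → c₁ * v₁ ^ t < C → c₂ * v₂ ^ t < C →
      c₁ * p ^ (1 + t) + c₂ * (1 - p) ^ (1 + t) ≤ C / (v₁ + v₂) ^ t) :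
    p = v₁ / (v₁ + v₂) := by
  have hVt : 0 < (v₁ + v₂) ^ t := Real.rpow_pos_of_pos hV t
  have hbd : 0 < C / (v₁ + v₂) ^ t + 1 := by positivity
  -- If `v₁ = 0`, the constraint on `c₁` is void, and a large `c₁` rules out `p > 0`.
  rcases hv₁.eq_or_lt with h1 | h1
  · subst h1
    by_contra hne
    have hp : 0 < p := lt_of_le_of_ne hp0 fun h => hne (by rw [← h, zero_div])
    have hpp : 0 < p ^ (1 + t) := Real.rpow_pos_of_pos hp _
    have := H ((C / (0 + v₂) ^ t + 1) / p ^ (1 + t)) 0 (by positivity) le_rfl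
      (by rw [Real.zero_rpow ht.ne', mul_zero]; exact hC) (by rw [zero_mul]; exact hC)
    rw [div_mul_cancel₀ _ hpp.ne'] at this
    linarith
  rcases hv₂.eq_or_lt with h2 | h2
  · subst h2
    by_contra hne
    have hp : 0 < 1 - p := lt_of_le_of_ne (by linarith) fun h => hne (by
      rw [add_zero, div_self h1.ne']; linarith)
    have hpp : 0 < (1 - p) ^ (1 + t) := Real.rpow_pos_of_pos hp _
    have := H 0 ((C / (v₁ + 0) ^ t + 1) / (1 - p) ^ (1 + t)) le_rfl (by positivity)
      (by rw [zero_mul]; exact hC) (by rw [Real.zero_rpow ht.ne', mul_zero]; exact hC)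
    rw [div_mul_cancel₀ _ hpp.ne'] at this
    linarith
  have hv1t : 0 < v₁ ^ t := Real.rpow_pos_of_pos h1 t
  have hv2t : 0 < v₂ ^ t := Real.rpow_pos_of_pos h2 t
  have hlim : C / v₁ ^ t * p ^ (1 + t) + C / v₂ ^ t * (1 - p) ^ (1 + t) ≤ C / (v₁ + v₂) ^ t := by
    have hcont : Tendsto (fun θ : ℝ => θ * (C / v₁ ^ t * p ^ (1 + t) +
        C / v₂ ^ t * (1 - p) ^ (1 + t))) (𝓝[<] 1)
        (𝓝 (1 * (C / v₁ ^ t * p ^ (1 + t) + C / v₂ ^ t * (1 - p) ^ (1 + t)))) :=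
      (tendsto_id.mul_const _).mono_left nhdsWithin_le_nhds
    rw [one_mul] at hcont
    refine le_of_tendsto hcont ?_
    filter_upwards [Ioo_mem_nhdsLT (show (0 : ℝ) < 1 by norm_num)] with θ hθ
    have hlt : θ * C < C := by nlinarith [hθ.2]
    have := H (θ * (C / v₁ ^ t)) (θ * (C / v₂ ^ t)) (by have := hθ.1; positivity)
      (by have := hθ.1; positivity)
      (by rwa [mul_assoc, div_mul_cancel₀ _ hv1t.ne'])
      (by rwa [mul_assoc, div_mul_cancel₀ _ hv2t.ne'])
    linarith
  by_contra hne
  have hab : p / v₁ ≠ (1 - p) / v₂ := by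
    intro h
    rw [div_eq_div_iff h1.ne' h2.ne'] at h
    exact hne (by rw [eq_div_iff hV.ne']; linarith)
  -- Strict Jensen with weights `vᵢ / (v₁ + v₂)` at the densities `p / v₁ ≠ (1 - p) / v₂`, whose
  -- mean is `1 / (v₁ + v₂)`.
  have hstrict := (strictConvexOn_rpow (p := 1 + t) (by linarith)).2
    (Set.mem_Ici.2 (div_nonneg hp0 h1.le)) (Set.mem_Ici.2 (div_nonneg (sub_nonneg.2 hp1) h2.le))
    hab (div_pos h1 hV) (div_pos h2 hV) (by rw [← add_div, div_self hV.ne'])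
  simp only [smul_eq_mul] at hstrict
  have e1 : v₁ / (v₁ + v₂) * (p / v₁) + v₂ / (v₁ + v₂) * ((1 - p) / v₂) = (v₁ + v₂)⁻¹ := by
    field_simp; ring
  have e2 : ∀ {q v : ℝ}, 0 ≤ q → 0 < v →
      v / (v₁ + v₂) * (q / v) ^ (1 + t) = (C / v ^ t * q ^ (1 + t)) / (C * (v₁ + v₂)) := by
    intro q v hq hv
    rw [Real.div_rpow hq hv.le, Real.rpow_add hv, Real.rpow_one]
    have := Real.rpow_pos_of_pos hv t
    field_simp
  have e3 : ((v₁ + v₂)⁻¹) ^ (1 + t) = (C / (v₁ + v₂) ^ t) / (C * (v₁ + v₂)) := by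
    rw [Real.inv_rpow hV.le, Real.rpow_add hV, Real.rpow_one]
    field_simp
  rw [e1, e2 hp0 h1, e2 (sub_nonneg.2 hp1) h2, e3, ← add_div,
    div_lt_div_iff_of_pos_right (by positivity)] at hstrict
  exact absurd hlim (not_le.2 hstrict)

end Convexity

/-! ### The counting measure as a proportion of points. -/

section CountingMeasure

variable {d : ℕ}

open Classical in
lemma countingMeasure_apply (ω : Finset (EuclideanSpace ℝ (Fin d)))
    {E : Set (EuclideanSpace ℝ (Fin d))} (hE : MeasurableSet E) :
    (countingMeasure ω : Measure (EuclideanSpace ℝ (Fin d))) E =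
      ENNReal.ofReal (((ω.filter (· ∈ E)).card : ℝ) / ω.card) := by
  have h1 : (countingMeasure ω : Measure (EuclideanSpace ℝ (Fin d))) E =
      ((ω.card : ℝ≥0)⁻¹ : ℝ≥0) * ((ω.filter (· ∈ E)).card : ℝ≥0∞) := by
    rw [countingMeasure, FiniteMeasure.toMeasure_smul, FiniteMeasure.toMeasure_sum]
    rw [Measure.smul_apply, Measure.finsetSum_apply, ENNReal.smul_def, smul_eq_mul]
    congr 1
    rw [Finset.card_filter]
    push_cast
    refine Finset.sum_congr rfl fun x _ => ?_
    change (diracProba x).toMeasure E = _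
    rw [diracProba_toMeasure_apply' _ hE, Set.indicator_apply]
    rfl
  rw [h1, div_eq_inv_mul, ENNReal.ofReal_mul (by positivity), ENNReal.ofReal_natCast]
  congr 1
  rw [ENNReal.ofReal]
  congr 1
  ext
  simp

lemma isProbabilityMeasure_countingMeasure {ω : Finset (EuclideanSpace ℝ (Fin d))}
    (h : ω.card ≠ 0) :
    IsProbabilityMeasure (countingMeasure ω : Measure (EuclideanSpace ℝ (Fin d))) := by
  classical
  constructor
  rw [countingMeasure_apply ω MeasurableSet.univ]
  simp [h]

end CountingMeasure

/-! ### From energy asymptotics to weak convergence. -/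

section Equidistribution

variable {d : ℕ}

open Classical in
/-- Asymptotically minimal configurations put the right proportion of points into a set whose
boundary is negligible. -/
lemma tendsto_card_filter_div {s t : ℝ} (ht : 0 < t) {C : ℝ≥0∞} (hC0 : C ≠ 0) (hCt : C ≠ ∞)
    {τ : ℕ → ℝ≥0∞} (hτ : Tendsto τ atTop (𝓝 ∞))
    (hratio : ∀ (l : Filter ℕ) (k : ℕ → ℕ) (p : ℝ), l ≤ atTop → (∀ N, k N ≤ N) → 0 ≤ p →
      Tendsto (fun N => (k N : ℝ) / N) l (𝓝 p) →
      Tendsto (fun N => τ (k N) / τ N) l (𝓝 (ENNReal.ofReal (p ^ (1 + t)))))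
    (hlow : ∀ B : Set (EuclideanSpace ℝ (Fin d)), IsCompact B → ∀ c : ℝ≥0∞, c ≠ ∞ →
      c * volume B ^ t < C → ∃ K : ℝ≥0∞, K ≠ ∞ ∧ ∀ ω : Finset (EuclideanSpace ℝ (Fin d)),
        (ω : Set _) ⊆ B → c * τ ω.card ≤ energy s ω + K)
    {A : Set (EuclideanSpace ℝ (Fin d))} (hA : IsCompact A) (hA0 : 0 < volume A)
    {ω : ℕ → Finset (EuclideanSpace ℝ (Fin d))} (hcard : ∀ N, (ω N).card = N)
    (hωA : ∀ N, (ω N : Set (EuclideanSpace ℝ (Fin d))) ⊆ A)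
    (hlim : Tendsto (fun N => energy s (ω N) / τ N) atTop (𝓝 (C / volume A ^ t)))
    {E : Set (EuclideanSpace ℝ (Fin d))} (hE : volume (A ∩ frontier E) = 0) :
    Tendsto (fun N => (((ω N).filter (· ∈ E)).card : ℝ) / N) atTop
      (𝓝 ((volume (A ∩ E)).toReal / (volume A).toReal)) := by
  have hAt : volume A ≠ ∞ := hA.measure_lt_top.ne
  set B₁ := A ∩ closure E
  set B₂ := A \ interior E
  have hB₁ : IsCompact B₁ := hA.inter_right isClosed_closure
  have hB₂ : IsCompact B₂ := hA.diff isOpen_interior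
  have hv₁ : volume B₁ = volume (A ∩ E) := by
    refine le_antisymm ?_ (measure_mono (Set.inter_subset_inter_right _ subset_closure))
    calc volume B₁ ≤ volume ((A ∩ E) ∪ (A ∩ frontier E)) := by
          refine measure_mono fun x hx => ?_
          by_cases hxE : x ∈ E
          · exact Or.inl ⟨hx.1, hxE⟩
          · exact Or.inr ⟨hx.1, hx.2, fun h => hxE (interior_subset h)⟩
      _ ≤ volume (A ∩ E) + volume (A ∩ frontier E) := measure_union_le _ _
      _ = volume (A ∩ E) := by rw [hE, add_zero]
  have hv₂ : volume B₂ = volume (A \ closure E) := by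
    refine le_antisymm ?_
      (measure_mono (Set.sdiff_subset_sdiff_right (interior_subset.trans subset_closure)))
    calc volume B₂ ≤ volume ((A \ closure E) ∪ (A ∩ frontier E)) := by
          refine measure_mono fun x hx => ?_
          by_cases hxE : x ∈ closure E
          · exact Or.inr ⟨hx.1, hxE, hx.2⟩
          · exact Or.inl ⟨hx.1, hxE⟩
      _ ≤ volume (A \ closure E) + volume (A ∩ frontier E) := measure_union_le _ _
      _ = _ := by rw [hE, add_zero]
  have hsum : volume B₁ + volume B₂ = volume A := by
    rw [hv₂]
    exact measure_inter_add_sdiff A isClosed_closure.measurableSet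
  have hB₁t : volume B₁ ≠ ∞ := hB₁.measure_lt_top.ne
  have hB₂t : volume B₂ ≠ ∞ := hB₂.measure_lt_top.ne
  have hsumR : (volume B₁).toReal + (volume B₂).toReal = (volume A).toReal := by
    rw [← ENNReal.toReal_add hB₁t hB₂t, hsum]
  set k : ℕ → ℕ := fun N => ((ω N).filter (· ∈ E)).card
  set k' : ℕ → ℕ := fun N => ((ω N).filter (· ∉ E)).card
  have hkk' : ∀ N, k N + k' N = N := fun N => by
    rw [Finset.card_filter_add_card_filter_not, hcard]
  have hk : ∀ N, k N ≤ N := fun N => (Nat.le_add_right _ _).trans (hkk' N).le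
  have hk' : ∀ N, k' N ≤ N := fun N => (Nat.le_add_left _ _).trans (hkk' N).le
  rw [← hv₁, ← hsumR]
  -- By compactness of `[0,1]` it suffices to identify each cluster point `p`, reached along an
  -- ultrafilter `l`; this is why `hratio` allows arbitrary filters.
  refine (isCompact_Icc (a := (0 : ℝ)) (b := 1)).tendsto_nhds_of_unique_mapClusterPt
    (Eventually.of_forall fun N => ⟨by positivity, ?_⟩) ?_
  · exact div_le_one_of_le₀ (by exact_mod_cast hk N) (by positivity)
  intro p hp hcl
  obtain ⟨l, hl, hlp⟩ := mapClusterPt_iff_ultrafilter.1 hcl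
  have hlp' : Tendsto (fun N => (k' N : ℝ) / N) l (𝓝 (1 - p)) := by
    refine (hlp.const_sub 1).congr' ?_
    filter_upwards [hl (eventually_gt_atTop 0)] with N hN
    have hN' : (N : ℝ) ≠ 0 := by exact_mod_cast hN.ne'
    have : (k N : ℝ) + k' N = N := by exact_mod_cast hkk' N
    field_simp
    linarith
  have hr := hratio l k p hl hk hp.1 hlp
  have hr' := hratio l k' (1 - p) hl hk' (sub_nonneg.2 hp.2) hlp'
  refine eq_div_of_forall_add_le ENNReal.toReal_nonneg ENNReal.toReal_nonneg
    (by rw [hsumR]; exact ENNReal.toReal_pos hA0.ne' hAt) hp.1 hp.2 ht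
    (ENNReal.toReal_pos hC0 hCt) ?_
  intro c₁ c₂ hc₁ hc₂ hcv₁ hcv₂
  have key : ∀ {c : ℝ} {B : Set (EuclideanSpace ℝ (Fin d))}, 0 ≤ c → volume B ≠ ∞ →
      c * (volume B).toReal ^ t < C.toReal → ENNReal.ofReal c * volume B ^ t < C := by
    intro c B hc hB h
    have h' := (ENNReal.ofReal_lt_iff_lt_toReal (by positivity) hCt).2 h
    rwa [ENNReal.ofReal_mul hc, ENNReal.toReal_rpow,
      ENNReal.ofReal_toReal (ENNReal.rpow_ne_top_of_nonneg ht.le hB)] at h'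
  obtain ⟨K₁, hK₁, hL₁⟩ := hlow B₁ hB₁ _ ENNReal.ofReal_ne_top (key hc₁ hB₁t hcv₁)
  obtain ⟨K₂, hK₂, hL₂⟩ := hlow B₂ hB₂ _ ENNReal.ofReal_ne_top (key hc₂ hB₂t hcv₂)
  have hineq : ∀ N, ENNReal.ofReal c₁ * (τ (k N) / τ N) + ENNReal.ofReal c₂ * (τ (k' N) / τ N) ≤
      energy s (ω N) / τ N + (K₁ + K₂) / τ N := by
    intro N
    rw [← mul_div_assoc, ← mul_div_assoc, ← ENNReal.add_div, ← ENNReal.add_div]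
    refine ENNReal.div_le_div_right ?_ _
    have h1 := hL₁ ((ω N).filter (· ∈ E)) fun x hx => by
      have := Finset.mem_filter.1 (Finset.mem_coe.1 hx)
      exact ⟨hωA N this.1, subset_closure this.2⟩
    have h2 := hL₂ ((ω N).filter (· ∉ E)) fun x hx => by
      have := Finset.mem_filter.1 (Finset.mem_coe.1 hx)
      exact ⟨hωA N this.1, fun h => this.2 (interior_subset h)⟩
    calc _ ≤ (energy s ((ω N).filter (· ∈ E)) + K₁) + (energy s ((ω N).filter (· ∉ E)) + K₂) :=
          add_le_add h1 h2
      _ = (energy s ((ω N).filter (· ∈ E)) + energy s ((ω N).filter (· ∉ E))) + (K₁ + K₂) := by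
          ring
      _ ≤ _ := by gcongr; exact energy_filter_add_le s (ω N) E
  have hKτ : Tendsto (fun N => (K₁ + K₂) / τ N) atTop (𝓝 0) := by
    have := ENNReal.Tendsto.const_div (a := K₁ + K₂) hτ (Or.inr (ENNReal.add_ne_top.2 ⟨hK₁, hK₂⟩))
    simpa using this
  have hR := (hlim.add hKτ).mono_left hl
  have hL := (ENNReal.Tendsto.const_mul (a := ENNReal.ofReal c₁) hr
    (Or.inr ENNReal.ofReal_ne_top)).add (ENNReal.Tendsto.const_mul (a := ENNReal.ofReal c₂) hr'
    (Or.inr ENNReal.ofReal_ne_top))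
  have hfin := le_of_tendsto_of_tendsto hL hR (Eventually.of_forall hineq)
  have hp1 := sub_nonneg.2 hp.2
  have hpp : 0 ≤ p := hp.1
  rw [add_zero, ← ENNReal.ofReal_mul hc₁, ← ENNReal.ofReal_mul hc₂,
    ← ENNReal.ofReal_add (by positivity) (by positivity)] at hfin
  have hAt0 : volume A ^ t ≠ 0 := (ENNReal.rpow_pos hA0 hAt).ne'
  rw [ENNReal.ofReal_le_iff_le_toReal (ENNReal.div_ne_top hCt hAt0), ENNReal.toReal_div,
    ← ENNReal.toReal_rpow] at hfin
  rwa [hsumR]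

/-- The portmanteau theorem needs only closed sets with boundary null for the limit. Keeping `τ`,
`t` and `C` abstract serves both normalizations. -/
theorem tendsto_countingMeasure {s t : ℝ} (ht : 0 < t) {C : ℝ≥0∞} (hC0 : C ≠ 0) (hCt : C ≠ ∞)
    {τ : ℕ → ℝ≥0∞} (hτ : Tendsto τ atTop (𝓝 ∞))
    (hratio : ∀ (l : Filter ℕ) (k : ℕ → ℕ) (p : ℝ), l ≤ atTop → (∀ N, k N ≤ N) → 0 ≤ p →
      Tendsto (fun N => (k N : ℝ) / N) l (𝓝 p) →
      Tendsto (fun N => τ (k N) / τ N) l (𝓝 (ENNReal.ofReal (p ^ (1 + t)))))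
    (hlow : ∀ B : Set (EuclideanSpace ℝ (Fin d)), IsCompact B → ∀ c : ℝ≥0∞, c ≠ ∞ →
      c * volume B ^ t < C → ∃ K : ℝ≥0∞, K ≠ ∞ ∧ ∀ ω : Finset (EuclideanSpace ℝ (Fin d)),
        (ω : Set _) ⊆ B → c * τ ω.card ≤ energy s ω + K)
    {A : Set (EuclideanSpace ℝ (Fin d))} (hA : IsCompact A) (hA0 : 0 < volume A)
    {ω : ℕ → Finset (EuclideanSpace ℝ (Fin d))} (hcard : ∀ N, (ω N).card = N)
    (hωA : ∀ N, (ω N : Set (EuclideanSpace ℝ (Fin d))) ⊆ A)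
    (hlim : Tendsto (fun N => energy s (ω N) / τ N) atTop (𝓝 (C / volume A ^ t))) :
    Tendsto (fun N => countingMeasure (ω N)) atTop (𝓝 (uniformMeasure A)) := by
  classical
  have hAt : volume A ≠ ∞ := hA.measure_lt_top.ne
  have hprob : IsProbabilityMeasure (ProbabilityTheory.cond volume A) :=
    ProbabilityTheory.cond_isProbabilityMeasure_of_finite hA0.ne' hAt
  -- The index is shifted because for `N = 0` the counting measure is zero, not a probability
  -- measure.
  rw [← tendsto_add_atTop_iff_nat 1]
  let μ : ProbabilityMeasure (EuclideanSpace ℝ (Fin d)) := ⟨ProbabilityTheory.cond volume A, hprob⟩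
  let μs : ℕ → ProbabilityMeasure (EuclideanSpace ℝ (Fin d)) := fun N =>
    ⟨countingMeasure (ω (N + 1)), isProbabilityMeasure_countingMeasure (by rw [hcard]; simp)⟩
  suffices h : Tendsto μs atTop (𝓝 μ) from
    (ProbabilityMeasure.tendsto_nhds_iff_toFiniteMeasure_tendsto_nhds _).1 h
  refine tendsto_of_forall_isClosed_limsup_le'
    (limsup_measure_closed_le_of_forall_tendsto_measure fun {E} hE hfr => ?_)
  have hcond : ∀ S, (μ : Measure (EuclideanSpace ℝ (Fin d))) S = (volume A)⁻¹ * volume (A ∩ S) :=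
    fun S => ProbabilityTheory.cond_apply hA.measurableSet _ _
  have hfr' : volume (A ∩ frontier E) = 0 := by
    rw [hcond] at hfr
    exact (mul_eq_zero.1 hfr).resolve_left (ENNReal.inv_ne_zero.2 hAt)
  have hmain := tendsto_card_filter_div ht hC0 hCt hτ hratio hlow hA hA0 hcard hωA hlim hfr'
  have h1 := (ENNReal.tendsto_ofReal hmain).comp (tendsto_add_atTop_nat 1)
  have hval : ENNReal.ofReal ((volume (A ∩ E)).toReal / (volume A).toReal) =
      (μ : Measure (EuclideanSpace ℝ (Fin d))) E := by
    rw [ENNReal.ofReal_div_of_pos (ENNReal.toReal_pos hA0.ne' hAt), ENNReal.ofReal_toReal hAt,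
      ENNReal.ofReal_toReal (measure_ne_top_of_subset Set.inter_subset_left hAt), hcond,
      div_eq_mul_inv, mul_comm]
  rw [hval] at h1
  refine h1.congr fun N => ?_
  have h2 := countingMeasure_apply (ω (N + 1)) hE
  rw [hcard] at h2
  exact h2.symm

end Equidistribution

/-! ### Ratios of the two normalizing sequences. -/

section Normalizations

lemma tendsto_rpow_ratio {t : ℝ} (ht : 0 < t) {l : Filter ℕ} {k : ℕ → ℕ} {p : ℝ} (hl : l ≤ atTop)
    (hlim : Tendsto (fun N => (k N : ℝ) / N) l (𝓝 p)) (hp : 0 ≤ p) :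
    Tendsto (fun N : ℕ => (k N : ℝ≥0∞) ^ (1 + t) / (N : ℝ≥0∞) ^ (1 + t)) l
      (𝓝 (ENNReal.ofReal (p ^ (1 + t)))) := by
  rw [← ENNReal.ofReal_rpow_of_nonneg hp (by positivity)]
  refine ((ENNReal.tendsto_ofReal hlim).ennrpow_const (1 + t)).congr' ?_
  filter_upwards [hl (eventually_gt_atTop 0)] with N hN
  rw [ENNReal.ofReal_div_of_pos (by exact_mod_cast hN), ENNReal.ofReal_natCast,
    ENNReal.ofReal_natCast, ENNReal.div_rpow_of_nonneg _ _ (by positivity)]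

/-- For `p > 0`, `log k / log N → 1`, as `log (k / N)` stays bounded. For `p = 0` this can fail, but
`log k ≤ log N` suffices. -/
lemma tendsto_sq_mul_log_ratio {l : Filter ℕ} {k : ℕ → ℕ} {p : ℝ} (hl : l ≤ atTop)
    (hk : ∀ N, k N ≤ N) (hlim : Tendsto (fun N => (k N : ℝ) / N) l (𝓝 p)) (hp : 0 ≤ p) :
    Tendsto (fun N : ℕ => ENNReal.ofReal ((k N : ℝ) ^ 2 * Real.log (k N)) /
      ENNReal.ofReal ((N : ℝ) ^ 2 * Real.log N)) l (𝓝 (ENNReal.ofReal (p ^ 2))) := by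
  have hlog : Tendsto (fun N : ℕ => Real.log N) l atTop :=
    (Real.tendsto_log_atTop.comp tendsto_natCast_atTop_atTop).mono_left hl
  suffices h : Tendsto (fun N : ℕ => ((k N : ℝ) / N) ^ 2 * (Real.log (k N) / Real.log N)) l
      (𝓝 (p ^ 2)) by
    refine (ENNReal.tendsto_ofReal h).congr' ?_
    filter_upwards [hl (eventually_gt_atTop 1)] with N hN
    have hN1 : (1 : ℝ) < N := by exact_mod_cast hN
    have := Real.log_pos hN1
    rw [← ENNReal.ofReal_div_of_pos (by positivity), div_pow, div_mul_div_comm]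
  rcases hp.eq_or_lt with rfl | hp
  · have h2 := hlim.pow 2
    rw [zero_pow two_ne_zero] at h2 ⊢
    refine squeeze_zero' (Eventually.of_forall fun N => ?_) ?_ h2
    · exact mul_nonneg (by positivity)
        (div_nonneg (Real.log_natCast_nonneg _) (Real.log_natCast_nonneg _))
    · refine Eventually.of_forall fun N => mul_le_of_le_one_right (by positivity) ?_
      refine div_le_one_of_le₀ ?_ (Real.log_natCast_nonneg _)
      rcases Nat.eq_zero_or_pos (k N) with h0 | h0
      · rw [h0, Nat.cast_zero, Real.log_zero]; exact Real.log_natCast_nonneg _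
      · exact Real.log_le_log (by exact_mod_cast h0) (by exact_mod_cast hk N)
  · have h1 : Tendsto (fun N : ℕ => Real.log ((k N : ℝ) / N) / Real.log N) l (𝓝 0) :=
      ((Real.continuousAt_log hp.ne').tendsto.comp hlim).div_atTop hlog
    have h2 : Tendsto (fun N : ℕ => Real.log (k N) / Real.log N) l (𝓝 1) := by
      have := h1.const_add 1
      rw [add_zero] at this
      refine this.congr' ?_
      filter_upwards [hl (eventually_gt_atTop 1), hlim.eventually (lt_mem_nhds hp)] with N hN hkN
      have hN1 : (1 : ℝ) < N := by exact_mod_cast hN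
      have hk0 : (k N : ℝ) ≠ 0 := fun h => by rw [h, zero_div] at hkN; exact lt_irrefl _ hkN
      have := Real.log_pos hN1
      rw [Real.log_div hk0 (by linarith), sub_div, div_self this.ne']
      ring
    simpa using (hlim.pow 2).mul h2

end Normalizations

end Riesz

/-- The first part says that the constant `C_{s,d}` is a genuine limit, finite and positive; the
second part is the equidistribution of asymptotically optimal configurations. Convergence in
`FiniteMeasure` is weak convergence, tested on bounded continuous functions. -/
theorem theorem2p2 (d : ℕ) (hd : 1 ≤ d) :
    (∀ s : ℝ, (d : ℝ) < s →
      Tendsto (fun N : ℕ =>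
          Riesz.minEnergy s (Riesz.unitCube d) N / (N : ℝ≥0∞) ^ (1 + s / (d : ℝ)))
        atTop (𝓝 (Riesz.cubeConst s d)) ∧
      0 < Riesz.cubeConst s d ∧ Riesz.cubeConst s d < ∞) ∧
    ∀ A : Set (EuclideanSpace ℝ (Fin d)), IsCompact A → 0 < volume A →
      ∀ ω : ℕ → Finset (EuclideanSpace ℝ (Fin d)),
        (∀ N, (ω N).card = N) → (∀ N, (ω N : Set (EuclideanSpace ℝ (Fin d))) ⊆ A) →
        ((∃ s : ℝ, (d : ℝ) < s ∧
            Tendsto (fun N : ℕ => Riesz.energy s (ω N) / (N : ℝ≥0∞) ^ (1 + s / (d : ℝ)))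
              atTop (𝓝 (Riesz.cubeConst s d / volume A ^ (s / (d : ℝ))))) ∨
          Tendsto (fun N : ℕ => Riesz.energy (d : ℝ) (ω N) /
              ENNReal.ofReal ((N : ℝ) ^ 2 * Real.log N))
            atTop (𝓝 (volume (Metric.closedBall (0 : EuclideanSpace ℝ (Fin d)) 1) / volume A))) →
        Tendsto (fun N : ℕ => Riesz.countingMeasure (ω N)) atTop (𝓝 (Riesz.uniformMeasure A)) := by
  have hd' : (0 : ℝ) < d := by exact_mod_cast hd
  refine ⟨fun s hs => ⟨Riesz.tendsto_minEnergy_unitCube hd hs, Riesz.cubeConst_pos hd hs,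
    Riesz.cubeConst_lt_top hd hs⟩, ?_⟩
  rintro A hA hA0 ω hcard hωA (⟨s, hs, hlim⟩ | hlim)
  · have ht : 0 < s / (d : ℝ) := div_pos (hd'.trans hs) hd'
    refine Riesz.tendsto_countingMeasure ht (Riesz.cubeConst_pos hd hs).ne'
      (Riesz.cubeConst_lt_top hd hs).ne (τ := fun N => (N : ℝ≥0∞) ^ (1 + s / (d : ℝ))) ?_
      (fun l k p hl _ hp h => Riesz.tendsto_rpow_ratio ht hl h hp)
      (fun B hB c hc hcB => Riesz.exists_rpow_card_le_energy_add hd hs hB hc hcB)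
      hA hA0 hcard hωA hlim
    have := ENNReal.tendsto_nat_nhds_top.ennrpow_const (1 + s / (d : ℝ))
    rwa [ENNReal.top_rpow_of_pos (by positivity)] at this
  · have : Nonempty (Fin d) := ⟨⟨0, hd⟩⟩
    have hball : volume (Metric.closedBall (0 : EuclideanSpace ℝ (Fin d)) 1) = Riesz.ballVol d :=
      Measure.addHaar_closedBall_eq_addHaar_ball _ _ _
    refine Riesz.tendsto_countingMeasure one_pos (C := Riesz.ballVol d) Riesz.ballVol_ne_zero
      Riesz.ballVol_ne_top (s := d)
      (τ := fun N => ENNReal.ofReal ((N : ℝ) ^ 2 * Real.log N)) ?_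
      (fun l k p hl hk hp h => ?_)
      (fun B hB c hc hcB => Riesz.exists_sq_card_mul_log_le_energy_add hd hB hc ?_)
      hA hA0 hcard hωA ?_
    · refine ENNReal.tendsto_ofReal_atTop.comp ?_
      exact ((tendsto_pow_atTop two_ne_zero).comp tendsto_natCast_atTop_atTop).atTop_mul_atTop₀
        (Real.tendsto_log_atTop.comp tendsto_natCast_atTop_atTop)
    · have := Riesz.tendsto_sq_mul_log_ratio hl hk h hp
      rwa [show (1 : ℝ) + 1 = (2 : ℕ) by norm_num, Real.rpow_natCast]
    · rwa [ENNReal.rpow_one] at hcB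
    · rwa [ENNReal.rpow_one, ← hball]
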